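/- Let $k\in\{1,2,3\}$ and let $d\ge 1$ be an integer. If $k=1$ let $D=(0,b)$ with $b>0$; if $k=2,3$ let $D=B_1(0)\subset\mathbb R^k$ be the open unit ball. Let $G_D^k$ be the Green function of the Laplace equation on $D$ with Dirichlet boundary condition, that is, $G^1_D(x,y)=x\wedge y-\frac{xy}{b}$, and for $k=2,3$ $$G_D^k(x,y)=\Gamma^k(|x-y|)-\Gamma^k\Big(|y|\,\Big|x-\frac{y}{|y|^2}\Big|\Big)\ (y\ne0),\qquad G_D^k(x,0)=\Gamma^k(|x|)-\Gamma^k(1),$$ with $\Gamma^2(r)=\frac1{2\pi}\log r$ and $\Gamma^3(r)=\frac1{4\pi r}$ (for $k=2$ this is the Green function of $-\Delta$ up to sign, which does not affect the law of the process $v$ below). Let $W=(W^1,\dots,W^d)$ be a $d$-dimensional Gaussian white noise on $D$, that is, the variables $W^i(h)=\int_D h(y)\,W^i(dy)$, $1\le i\le d$, $h\in L^2(D)$, are jointly Gaussian and centred with $\mathbb E[W^i(g)W^j(h)]=\delta_{ij}\langle g,h\rangle_{L^2(D)}$. Let $v=\{v(x),\,x\in D\}$ be the $\mathbb R^d$-valued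 Gaussian process $$v^i(x)=\int_D G_D^k(x,y)\,W^i(dy),\qquad x\in D,\ i=1,\dots,d,$$ in a version with almost surely continuous sample paths. Let $\xi=1$ if $k=1$, $\xi=1-\gamma$ with an arbitrary $\gamma\in(0,1)$ if $k=2$, and $\xi=\frac12$ if $k=3$. Then for every $d_0>0$ there exists a constant $C>0$, depending only on $D,k,d,d_0$ (and on $\gamma$ if $k=2$), such that for every compact set $I\subset D$ all of whose points have distance at least $d_0$ from $\partial D$, and every Borel set $A\subset\mathbb R^d$, $$P\{v(I)\cap A\neq\emptyset\}\le C\,\mathcal H_{d-\frac k\xi}(A).$$ Here $\mathcal H_s$ is the $s$-dimensional Hausdorff measure on $\mathbb R^d$; for $s<0$, $\mathcal H_s(A)=\infty$ if $A\ne\emptyset$ and $\mathcal H_s(\emptyset)=0$. -/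

import Mathlib

open MeasureTheory ProbabilityTheory

namespace PoissonHitting

/-- `ℝ^n` with its Euclidean norm. -/
abbrev Euc (n : ℕ) : Type := EuclideanSpace ℝ (Fin n)

/-- The domain `D ⊂ ℝ^k`: the interval `(0, b)` if `k = 1`, and the open unit ball (which does
not involve `b`) otherwise. -/
def domain (k : ℕ) (b : ℝ) : Set (Euc k) :=
  if k = 1 then {x | ∀ i, x i ∈ Set.Ioo 0 b} else Metric.ball 0 1

/-- The radial function `Γ^k`: `(2π)⁻¹ log r` if `k = 2`, and `(4π)⁻¹ r⁻¹` if `k = 3`.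
Only `k = 2, 3` are used. -/
noncomputable def fundSol (k : ℕ) (r : ℝ) : ℝ :=
  if k = 2 then 1 / (2 * Real.pi) * Real.log r else 1 / (4 * Real.pi) * r⁻¹

/-- The Green function of the Laplace equation on `domain k b` with Dirichlet boundary condition,
for `k = 1, 2, 3`. For `k = 2` the sign is that of `Γ^2 = (2π)⁻¹ log`; as white noise is symmetric,
the sign is irrelevant for the law of the process below. The value at `x = y` (`k = 2, 3`) is
immaterial, since only the class of `y ↦ green k b x y` in `L²(D)` is used. -/
noncomputable def green : (k : ℕ) → ℝ → Euc k → Euc k → ℝ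
  | 1, b, x, y => min (x 0) (y 0) - x 0 * y 0 / b
  | k, _, x, y =>
    if y = 0 then fundSol k ‖x‖ - fundSol k 1
    else fundSol k ‖x - y‖ - fundSol k (‖y‖ * ‖x - (‖y‖ ^ 2)⁻¹ • y‖)

/-- The exponent `ξ`: `1`, `1 - γ`, `1/2` for `k = 1, 2, 3`. -/
noncomputable def xi (k : ℕ) (γ : ℝ) : ℝ :=
  if k = 1 then 1 else if k = 2 then 1 - γ else 1 / 2

/-- `W = (W^1, …, W^d)` is a `d`-dimensional Gaussian white noise with control measure `μ`: the
`W^i(h)`, `h ∈ L²(μ)`, are jointly Gaussian and centred, and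
`E[W^i(g) W^j(h)] = δ_{ij} ⟨g, h⟩_{L²(μ)}`. -/
structure IsWhiteNoise {S Ω : Type*} [MeasurableSpace S] [MeasurableSpace Ω] {d : ℕ}
    (μ : Measure S) (W : Fin d → Lp ℝ 2 μ → Ω → ℝ) (P : Measure Ω) : Prop where
  isGaussianProcess : IsGaussianProcess (fun p : Fin d × Lp ℝ 2 μ => W p.1 p.2) P
  mean_zero : ∀ (i : Fin d) (h : Lp ℝ 2 μ), ∫ ω, W i h ω ∂P = 0
  covariance : ∀ (i j : Fin d) (g h : Lp ℝ 2 μ),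
    ∫ ω, W i g ω * W j h ω ∂P = if i = j then inner ℝ g h else 0

open Classical in
/-- The Wiener integral `∫ h dW` of a (deterministic) square integrable function `h` with respect
to one component of a white noise; it is set to `0` if `h ∉ L²(μ)`. -/
noncomputable def wienerIntegral {S Ω : Type*} [MeasurableSpace S] {μ : Measure S}
    (W : Lp ℝ 2 μ → Ω → ℝ) (h : S → ℝ) : Ω → ℝ :=
  if hh : MemLp h 2 μ then W (hh.toLp h) else 0

/-- `v` is the Gaussian process `v^i(x) = ∫_D G_D^k(x, y) W^i(dy)`, `x ∈ D`, `i = 1, …, d`, in a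
version with almost surely continuous sample paths on `D`. -/
structure IsGaussianSolution {Ω : Type*} [MeasurableSpace Ω] {k d : ℕ} (b : ℝ)
    (W : Fin d → Lp ℝ 2 ((volume : Measure (Euc k)).restrict (domain k b)) → Ω → ℝ)
    (v : Euc k → Ω → Euc d) (P : Measure Ω) : Prop where
  ae_eq : ∀ x ∈ domain k b, ∀ i : Fin d,
    (fun ω => v x ω i) =ᵐ[P] wienerIntegral (W i) (green k b x)
  ae_continuousOn : ∀ᵐ ω ∂P, ContinuousOn (fun x => v x ω) (domain k b)

end PoissonHitting

open PoissonHitting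

/-!
Fix a small cube `Q` of side `δ` with corner `a`. Each component of `v` decomposes on `Q` as
`v^i(x) = c(x) v^i(a) + R^i(x)`, where `c(x) v^i(a)` is the projection on `v^i(a)` and the
residual `R^i` is independent of `v^i(a)`. Since `x ↦ G_D^k(x, ·) ∈ L²(D)` is Hölder continuous of
exponent `ξ` away from `∂D`, chaining gives `E sup_Q |R^i| = O(δ^ξ)`, and `|c(x) - 1| = O(δ^ξ)`.
Conditionally on `R^i`, the component can come within `ε = δ^ξ` of a given `z` on `Q` only if
`v^i(a)`, whose density is bounded, lies in an interval of length `O(ε + sup_Q |R^i|)`, so this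
has probability `O(ε)`. By independence of the components, `v(Q)` meets a given ball of radius `ε`
with probability `O(ε^d)`. A bounded set is covered by `O(δ^{-k}) = O(ε^{-k/ξ})` such cubes, so
`v(I)` meets a given ball of radius `ε` with probability `O(ε^{d - k/ξ})`, and covering `A` by
balls gives the Hausdorff measure.
-/

namespace PoissonHitting

open Set Filter
open scoped ENNReal NNReal Topology RealInnerProductSpace

section Hausdorff

variable {Ω X : Type*} [MeasurableSpace Ω] {P : Measure Ω} [EMetricSpace X] [MeasurableSpace X]
  [BorelSpace X] {Z : Ω → Set X} {C : ℝ≥0∞} {s : ℝ}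

theorem measure_inter_nonempty_le_hausdorffMeasure {r : ℝ≥0∞} (hC : C ≠ 0) (hC' : C ≠ ∞)
    (hr : 0 < r) (h : ∀ E : Set X, E.Nonempty → Metric.ediam E ≤ r →
      P {ω | (Z ω ∩ E).Nonempty} ≤ C * Metric.ediam E ^ s) (A : Set X) :
    P {ω | (Z ω ∩ A).Nonempty} ≤ C * μH[s] A := by
  rw [mul_comm, ← ENNReal.div_le_iff_le_mul (.inl hC) (.inl hC'), Measure.hausdorffMeasure_apply]
  refine le_iSup₂_of_le r hr (le_iInf fun t => le_iInf fun hA => le_iInf fun ht => ?_)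
  rw [ENNReal.div_le_iff_le_mul (.inl hC) (.inl hC'), mul_comm, ← ENNReal.tsum_mul_left]
  have hcover : {ω | (Z ω ∩ A).Nonempty} ⊆ ⋃ n, {ω | (Z ω ∩ t n).Nonempty} := by
    rintro ω ⟨x, hxZ, hxA⟩
    obtain ⟨n, hn⟩ := mem_iUnion.1 (hA hxA)
    exact mem_iUnion.2 ⟨n, x, hxZ, hn⟩
  refine (measure_mono hcover).trans <| (measure_iUnion_le _).trans <|
    ENNReal.tsum_le_tsum fun n => ?_
  rcases (t n).eq_empty_or_nonempty with hn | hn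
  · simp [hn]
  · simpa [hn] using h _ hn (ht n)

theorem measure_inter_nonempty_le_hausdorffMeasure_of_closedEBall {r : ℝ≥0} (hC : C ≠ 0)
    (hC' : C ≠ ∞) (hr : 0 < r)
    (h : ∀ z, ∀ ε : ℝ≥0∞, 0 < ε → ε ≤ r →
      P {ω | (Z ω ∩ Metric.closedEBall z ε).Nonempty} ≤ C * ε ^ s) (A : Set X) :
    P {ω | (Z ω ∩ A).Nonempty} ≤ C * μH[s] A := by
  refine measure_inter_nonempty_le_hausdorffMeasure (r := (r / 2 : ℝ≥0)) hC hC'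
    (by simpa using hr.ne') (fun E ⟨z, hz⟩ hE => ?_) A
  have hlt : Metric.ediam E < r := hE.trans_lt (by exact_mod_cast half_lt_self hr)
  have : (𝓝[>] Metric.ediam E).NeBot := nhdsGT_neBot_of_exists_gt ⟨r, hlt⟩
  -- Radii strictly larger than the diameter are needed, as the latter may vanish.
  have hball : ∀ᶠ ε in 𝓝[>] (Metric.ediam E),
      P {ω | (Z ω ∩ E).Nonempty} ≤ C * ε ^ s := by
    filter_upwards [Ioo_mem_nhdsGT hlt] with ε hε
    refine (measure_mono fun ω => Nonempty.mono (inter_subset_inter_right _ fun y hy => ?_)).trans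
      (h z ε (pos_of_gt hε.1) hε.2.le)
    exact (Metric.edist_le_ediam_of_mem hy hz).trans hε.1.le
  exact ge_of_tendsto ((((ENNReal.continuous_const_mul hC').comp
    ENNReal.continuous_rpow_const).tendsto _).mono_left nhdsWithin_le_nhds) hball

end Hausdorff

section MaximalInequality

variable {Ω E ι : Type*} [MeasurableSpace Ω] {P : Measure Ω} [NormedAddCommGroup E]

theorem lintegral_iSup_enorm_le [IsProbabilityMeasure P] [Fintype ι] {f : ι → Ω → E} {q : ℝ≥0}
    {s : ℝ≥0∞} (hq : 1 ≤ q) (hf : ∀ i, AEStronglyMeasurable (f i) P)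
    (hs : ∀ i, eLpNorm (f i) q P ≤ s) :
    ∫⁻ ω, ⨆ i, ‖f i ω‖ₑ ∂P ≤ (Fintype.card ι : ℝ≥0∞) ^ (q : ℝ)⁻¹ * s := by
  have hq0 : (0 : ℝ) < q := zero_lt_one.trans_le (by exact_mod_cast hq)
  have hsup : AEMeasurable (fun ω => ⨆ i, ‖f i ω‖ₑ) P := .iSup fun i => (hf i).enorm
  have hmoment : ∀ i, ∫⁻ ω, ‖f i ω‖ₑ ^ (q : ℝ) ∂P ≤ s ^ (q : ℝ) := fun i => by
    rw [← ENNReal.rpow_inv_le_iff hq0, ← one_div,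
      ← eLpNorm_nnreal_eq_lintegral (by exact_mod_cast hq0.ne')]
    exact hs i
  calc ∫⁻ ω, ⨆ i, ‖f i ω‖ₑ ∂P
      = eLpNorm (fun ω => ⨆ i, ‖f i ω‖ₑ) 1 P := by simp [eLpNorm_one_eq_lintegral_enorm]
    _ ≤ eLpNorm (fun ω => ⨆ i, ‖f i ω‖ₑ) q P :=
        eLpNorm_le_eLpNorm_of_exponent_le (by exact_mod_cast hq) hsup.aestronglyMeasurable
    _ = (∫⁻ ω, (⨆ i, ‖f i ω‖ₑ) ^ (q : ℝ) ∂P) ^ (q : ℝ)⁻¹ := by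
        rw [eLpNorm_nnreal_eq_lintegral (by exact_mod_cast hq0.ne')]
        simp
    _ ≤ (∫⁻ ω, ∑ i, ‖f i ω‖ₑ ^ (q : ℝ) ∂P) ^ (q : ℝ)⁻¹ := by
        gcongr with ω
        rw [← ENNReal.le_rpow_inv_iff hq0]
        refine iSup_le fun i => (ENNReal.le_rpow_inv_iff hq0).2 ?_
        exact Finset.single_le_sum (f := fun i => ‖f i ω‖ₑ ^ (q : ℝ)) (fun _ _ => zero_le)
          (Finset.mem_univ i)
    _ = (∑ i, ∫⁻ ω, ‖f i ω‖ₑ ^ (q : ℝ) ∂P) ^ (q : ℝ)⁻¹ := by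
        rw [lintegral_finsetSum' _ fun i _ => (hf i).enorm.pow_const _]
    _ ≤ (∑ _i : ι, s ^ (q : ℝ)) ^ (q : ℝ)⁻¹ := by
        gcongr with i
        exact hmoment i
    _ = (Fintype.card ι : ℝ≥0∞) ^ (q : ℝ)⁻¹ * s := by
        rw [Finset.sum_const, nsmul_eq_mul, Finset.card_univ,
          ENNReal.mul_rpow_of_nonneg _ _ (by positivity), ENNReal.rpow_rpow_inv hq0.ne']

end MaximalInequality

/-- An isonormal Gaussian process: a centred Gaussian process indexed by an inner product space,
whose covariance is the inner product. -/
structure IsIsonormal {Ω H : Type*} [MeasurableSpace Ω] [NormedAddCommGroup H]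
    [InnerProductSpace ℝ H] (X : H → Ω → ℝ) (P : Measure Ω) : Prop where
  isGaussianProcess : IsGaussianProcess X P
  mean_zero : ∀ h, ∫ ω, X h ω ∂P = 0
  covariance : ∀ g h, ∫ ω, X g ω * X h ω ∂P = ⟪g, h⟫

/-- The constant of the chaining bound for a tree with at most `θ ^ (-q n)` points at level `n` and
edges of length `θ ^ (2 n)` between levels `n` and `n + 1`. -/
noncomputable def chainingConst (θ : ℝ≥0∞) (q : ℝ≥0) : ℝ≥0∞ :=
  (1 - θ)⁻¹ * θ⁻¹ * eLpNorm id q (gaussianReal 0 1)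

theorem chainingConst_ne_top {θ : ℝ≥0∞} (hθ : θ ≠ 0) (hθ1 : θ < 1) (q : ℝ≥0) :
    chainingConst θ q ≠ ∞ :=
  ENNReal.mul_ne_top (ENNReal.mul_ne_top (ENNReal.inv_ne_top.2 (tsub_pos_of_lt hθ1).ne')
    (ENNReal.inv_ne_top.2 hθ)) (memLp_id_gaussianReal q).eLpNorm_ne_top

namespace IsIsonormal

variable {Ω H : Type*} [MeasurableSpace Ω] {P : Measure Ω} [NormedAddCommGroup H]
  [InnerProductSpace ℝ H] {X : H → Ω → ℝ}

theorem memLp_two (hX : IsIsonormal X P) (h : H) : MemLp (X h) 2 P :=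
  (hX.isGaussianProcess.hasGaussianLaw_eval h).memLp_two

theorem aemeasurable (hX : IsIsonormal X P) (h : H) : AEMeasurable (X h) P :=
  hX.isGaussianProcess.aemeasurable h

theorem covariance_eq_inner (hX : IsIsonormal X P) (g h : H) : cov[X g, X h; P] = ⟪g, h⟫ := by
  have := hX.isGaussianProcess.isProbabilityMeasure
  rw [covariance_eq_sub (hX.memLp_two g) (hX.memLp_two h), hX.mean_zero, hX.mean_zero]
  simpa using hX.covariance g h

theorem map_eq_gaussianReal (hX : IsIsonormal X P) (h : H) :
    P.map (X h) = gaussianReal 0 (‖h‖₊ ^ 2) := by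
  have hvar : Var[X h; P] = ‖h‖ ^ 2 := by
    rw [← covariance_self (hX.aemeasurable h), hX.covariance_eq_inner, real_inner_self_eq_norm_sq]
  rw [(hX.isGaussianProcess.hasGaussianLaw_eval h).map_eq_gaussianReal, hX.mean_zero, hvar]
  congr 1
  ext
  simp

theorem ae_add_smul_eq (hX : IsIsonormal X P) (g h : H) (c : ℝ) :
    X (g + c • h) =ᵐ[P] fun ω => X g ω + c * X h ω := by
  have hint : ∀ a b : H, Integrable (fun ω => X a ω * X b ω) P := fun a b =>
    (hX.memLp_two a).integrable_mul (hX.memLp_two b)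
  have hmemLp : MemLp (fun ω => X (g + c • h) ω - X g ω - c * X h ω) 2 P :=
    ((hX.memLp_two _).sub (hX.memLp_two _)).sub ((hX.memLp_two h).const_mul c)
  have hsq : ∫ ω, (X (g + c • h) ω - X g ω - c * X h ω) ^ 2 ∂P = 0 := by
    have hexpand : ∀ ω, (X (g + c • h) ω - X g ω - c * X h ω) ^ 2 =
        X (g + c • h) ω * X (g + c • h) ω + X g ω * X g ω + c ^ 2 * (X h ω * X h ω)
        - 2 * (X (g + c • h) ω * X g ω) - 2 * c * (X (g + c • h) ω * X h ω)
        + 2 * c * (X g ω * X h ω) := fun ω => by ring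
    simp_rw [hexpand]
    rw [integral_add, integral_sub, integral_sub, integral_add, integral_add]
    · simp only [integral_const_mul, hX.covariance, inner_add_left, inner_add_right,
        inner_smul_left, inner_smul_right, real_inner_comm g h, conj_trivial]
      ring
    all_goals fun_prop (disch := exact hint _ _)
  filter_upwards [(integral_eq_zero_iff_of_nonneg (fun ω => sq_nonneg _) hmemLp.integrable_sq).1
    hsq] with ω hω
  linarith [pow_eq_zero_iff two_ne_zero |>.1 hω]

theorem ae_sub_eq (hX : IsIsonormal X P) (g h : H) :
    X (g - h) =ᵐ[P] fun ω => X g ω - X h ω := by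
  simpa [sub_eq_add_neg] using hX.ae_add_smul_eq g h (-1)

theorem ae_zero_eq (hX : IsIsonormal X P) : X 0 =ᵐ[P] 0 := by
  filter_upwards [hX.ae_sub_eq 0 0] with ω hω
  simpa using hω

theorem eLpNorm_eq (hX : IsIsonormal X P) (h : H) (q : ℝ≥0∞) :
    eLpNorm (X h) q P = ‖h‖ₑ * eLpNorm id q (gaussianReal 0 1) := by
  have hscale : gaussianReal 0 (‖h‖₊ ^ 2) = (gaussianReal 0 1).map (‖h‖ * ·) := by
    rw [gaussianReal_map_const_mul]
    congr 1
    · simp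
    · ext; simp
  calc eLpNorm (X h) q P
      = eLpNorm id q (P.map (X h)) :=
        (eLpNorm_map_measure aestronglyMeasurable_id (hX.aemeasurable h)).symm
    _ = eLpNorm (‖h‖ • id) q (gaussianReal 0 1) := by
        rw [hX.map_eq_gaussianReal, hscale,
          eLpNorm_map_measure aestronglyMeasurable_id (by fun_prop)]
        rfl
    _ = ‖h‖ₑ * eLpNorm id q (gaussianReal 0 1) := by rw [eLpNorm_const_smul, enorm_norm]

section Chaining

variable {ι : ℕ → Type*} {π : ∀ n, ι (n + 1) → ι n} {h : ∀ n, ι n → H}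

theorem ae_enorm_le_tsum_iSup_enorm_sub [∀ n, Countable (ι n)] (hX : IsIsonormal X P)
    (h0 : ∀ i, h 0 i = 0) :
    ∀ᵐ ω ∂P, ∀ n i, ‖X (h n i) ω‖ₑ ≤
      ∑' m, ⨆ j : ι (m + 1), ‖X (h (m + 1) j - h m (π m j)) ω‖ₑ := by
  have hsub : ∀ᵐ ω ∂P, ∀ m (j : ι (m + 1)), X (h (m + 1) j - h m (π m j)) ω =
      X (h (m + 1) j) ω - X (h m (π m j)) ω := by
    simp_rw [ae_all_iff]
    exact fun m j => hX.ae_sub_eq _ _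
  filter_upwards [hsub, hX.ae_zero_eq] with ω hω hω0 n i
  suffices hpartial : ∀ n (i : ι n), ‖X (h n i) ω‖ₑ ≤
      ∑ m ∈ Finset.range n, ⨆ j : ι (m + 1), ‖X (h (m + 1) j - h m (π m j)) ω‖ₑ from
    (hpartial n i).trans (ENNReal.sum_le_tsum _)
  intro n
  induction n with
  | zero => intro i; simp [h0, hω0]
  | succ n ih =>
    intro i
    calc ‖X (h (n + 1) i) ω‖ₑ
        = ‖X (h n (π n i)) ω + X (h (n + 1) i - h n (π n i)) ω‖ₑ := by rw [hω]; ring_nf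
      _ ≤ ‖X (h n (π n i)) ω‖ₑ + ‖X (h (n + 1) i - h n (π n i)) ω‖ₑ := enorm_add_le _ _
      _ ≤ _ := by
        rw [Finset.sum_range_succ]
        exact add_le_add (ih _) (le_iSup (fun j => ‖X (h (n + 1) j - h n (π n j)) ω‖ₑ) i)

theorem lintegral_iSup_enorm_chain_le [∀ n, Fintype (ι n)] (hX : IsIsonormal X P) {θ s : ℝ≥0∞}
    {q : ℝ≥0} (hθ : θ ≠ 0) (hθ' : θ ≠ ∞) (hq : 1 ≤ q)
    (hcard : ∀ n, (Fintype.card (ι n) : ℝ≥0∞) ≤ (θ⁻¹ ^ n) ^ (q : ℝ)) (h0 : ∀ i, h 0 i = 0)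
    (hstep : ∀ n (i : ι (n + 1)), ‖h (n + 1) i - h n (π n i)‖ₑ ≤ s * θ ^ (2 * n)) :
    ∫⁻ ω, ⨆ p : Σ n, ι n, ‖X (h p.1 p.2) ω‖ₑ ∂P ≤ chainingConst θ q * s := by
  have := hX.isGaussianProcess.isProbabilityMeasure
  have hq0 : (0 : ℝ) < q := zero_lt_one.trans_le (by exact_mod_cast hq)
  set M := eLpNorm id q (gaussianReal 0 1)
  have hlevel : ∀ m, ∫⁻ ω, ⨆ j : ι (m + 1), ‖X (h (m + 1) j - h m (π m j)) ω‖ₑ ∂P ≤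
      θ ^ m * (θ⁻¹ * M * s) := fun m =>
    calc ∫⁻ ω, ⨆ j : ι (m + 1), ‖X (h (m + 1) j - h m (π m j)) ω‖ₑ ∂P
        ≤ (Fintype.card (ι (m + 1)) : ℝ≥0∞) ^ (q : ℝ)⁻¹ * (s * θ ^ (2 * m) * M) :=
          lintegral_iSup_enorm_le hq (fun j => (hX.memLp_two _).1) fun j => by
            rw [hX.eLpNorm_eq]
            gcongr
            exact hstep m j
      _ ≤ θ⁻¹ ^ (m + 1) * (s * θ ^ (2 * m) * M) := by
          gcongr
          exact (ENNReal.rpow_inv_le_iff hq0).2 (hcard (m + 1))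
      _ = (θ⁻¹ * θ) ^ m * (θ ^ m * (θ⁻¹ * M * s)) := by ring
      _ = θ ^ m * (θ⁻¹ * M * s) := by rw [ENNReal.inv_mul_cancel hθ hθ', one_pow, one_mul]
  calc ∫⁻ ω, ⨆ p : Σ n, ι n, ‖X (h p.1 p.2) ω‖ₑ ∂P
      ≤ ∫⁻ ω, ∑' m, ⨆ j : ι (m + 1), ‖X (h (m + 1) j - h m (π m j)) ω‖ₑ ∂P := by
        refine lintegral_mono_ae ?_
        filter_upwards [hX.ae_enorm_le_tsum_iSup_enorm_sub (π := π) h0] with ω hω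
        exact iSup_le fun p => hω p.1 p.2
    _ = ∑' m, ∫⁻ ω, ⨆ j : ι (m + 1), ‖X (h (m + 1) j - h m (π m j)) ω‖ₑ ∂P :=
        lintegral_tsum fun m => .iSup fun j => (hX.aemeasurable _).enorm
    _ ≤ ∑' m, θ ^ m * (θ⁻¹ * M * s) := ENNReal.tsum_le_tsum hlevel
    _ = chainingConst θ q * s := by
        rw [ENNReal.tsum_mul_right, ENNReal.tsum_geometric, chainingConst]
        ring

end Chaining

section SmallBall

variable {g₀ : H}

theorem indepFun_iSup_orthogonal (hX : IsIsonormal X P) {ι : Type*} [Countable ι] {g : ι → H}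
    (hg : ∀ t, ⟪g₀, g t⟫ = 0) : IndepFun (X g₀) (fun ω => ⨆ t, ‖X (g t) ω‖ₑ) P := by
  have hjoint : IsGaussianProcess (Sum.elim (fun _ : Unit => X g₀) fun t => X (g t)) P := by
    convert! hX.isGaussianProcess.comp_right (Sum.elim (fun _ : Unit => g₀) g) using 1
    ext (_ | _) <;> rfl
  have hindep := hjoint.indepFun_of_covariance_eq_zero (fun _ => hX.aemeasurable _)
    (fun _ => hX.aemeasurable _) fun _ t => by rw [hX.covariance_eq_inner, hg t]
  exact hindep.comp (φ := fun y : Unit → ℝ => y ()) (ψ := fun y : ι → ℝ => ⨆ t, ‖y t‖ₑ)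
    (by fun_prop) (by fun_prop)

theorem ae_enorm_sub_le (hX : IsIsonormal X P) (hg₀ : g₀ ≠ 0) (h : H) :
    ∀ᵐ ω ∂P, ‖X g₀ ω - X h ω‖ₑ ≤
      ‖h - g₀‖ₑ / ‖g₀‖ₑ * ‖X g₀ ω‖ₑ + ‖X ((ℝ ∙ g₀)ᗮ.starProjection h) ω‖ₑ := by
  set r := (ℝ ∙ g₀)ᗮ.starProjection h
  obtain ⟨c, hc⟩ : ∃ c : ℝ, (ℝ ∙ g₀).starProjection h = c • g₀ :=
    ⟨_, Submodule.starProjection_singleton ℝ h⟩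
  have hdecomp : h = r + c • g₀ := by
    rw [← hc, add_comm, Submodule.starProjection_add_starProjection_orthogonal]
  have hcoeff : ‖1 - c‖ₑ ≤ ‖h - g₀‖ₑ / ‖g₀‖ₑ := by
    have hproj : (ℝ ∙ g₀).starProjection (g₀ - h) = (1 - c) • g₀ := by
      rw [map_sub, hc, Submodule.starProjection_eq_self_iff.2 (Submodule.mem_span_singleton_self _),
        sub_smul, one_smul]
    rw [ENNReal.le_div_iff_mul_le (.inl (by simpa)) (.inl (by simp)), ← enorm_smul, ← hproj,
      enorm_le_iff_norm_le, norm_sub_rev h]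
    exact Submodule.norm_starProjection_apply_le _ _
  filter_upwards [hX.ae_add_smul_eq r g₀ c] with ω hω
  rw [← hdecomp] at hω
  calc ‖X g₀ ω - X h ω‖ₑ = ‖(1 - c) * X g₀ ω - X r ω‖ₑ := by rw [hω]; ring_nf
    _ ≤ ‖1 - c‖ₑ * ‖X g₀ ω‖ₑ + ‖X r ω‖ₑ := by rw [← enorm_mul]; exact enorm_sub_le
    _ ≤ _ := by gcongr

end SmallBall

end IsIsonormal

/-- The points of `ℝ` at relative distance at most `u` from `z`. The distance is relative because
the projection coefficient `c(x)` on `v^i(a)` is only close to `1`, which costs a multiple of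
`|v^i(a)|`. -/
def relBall (z : ℝ) (u : ℝ≥0∞) : Set ℝ :=
  {x | ‖x - z‖ₑ ≤ u * (1 + ‖x‖ₑ)}

section RelBall

variable {x z : ℝ} {t : ℝ≥0}

theorem mem_relBall_coe : x ∈ relBall z t ↔ |x - z| ≤ t * (1 + |x|) := by
  rw [relBall, mem_ofPred_eq, enorm_eq_nnnorm, enorm_eq_nnnorm, ← ENNReal.coe_one,
    ← ENNReal.coe_add, ← ENNReal.coe_mul, ENNReal.coe_le_coe, ← NNReal.coe_le_coe]
  rfl

theorem one_add_abs_le_of_mem_relBall (ht : (t : ℝ) ≤ 1 / 2) (hx : x ∈ relBall z t) :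
    1 + |z| ≤ 2 * (1 + |x|) := by
  have hxz := mem_relBall_coe.1 hx
  rw [abs_sub_comm] at hxz
  nlinarith [abs_sub_abs_le_abs_sub z x, abs_nonneg x]

theorem relBall_subset_closedBall (ht : (t : ℝ) ≤ 1 / 2) :
    relBall z t ⊆ Metric.closedBall z (2 * t * (1 + |z|)) := by
  intro x hx
  have hxz := mem_relBall_coe.1 hx
  rw [Metric.mem_closedBall, Real.dist_eq]
  have hx2 : 1 + |x| ≤ 2 * (1 + |z|) := by
    nlinarith [abs_sub_abs_le_abs_sub x z, abs_nonneg x]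
  nlinarith [t.2]

end RelBall

theorem gaussianPDFReal_le_div_one_add_abs {v₁ v₂ v : ℝ≥0} (hv₁ : v₁ ≠ 0) (hv : v ∈ Icc v₁ v₂)
    (x : ℝ) : gaussianPDFReal 0 v x ≤ (√(2 * Real.pi * v₁))⁻¹ * (1 + 2 * v₂) / (1 + |x|) := by
  have h₁ : (v₁ : ℝ) ≤ v := hv.1
  have h₂ : (v : ℝ) ≤ v₂ := hv.2
  have hv₁0 : (0 : ℝ) < v₁ := NNReal.coe_pos.2 (pos_iff_ne_zero.2 hv₁)
  have hv0 : (0 : ℝ) < v := hv₁0.trans_le h₁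
  have hv₂0 : (0 : ℝ) < v₂ := hv0.trans_le h₂
  have hpos : 0 < 1 + x ^ 2 / (2 * v₂) := by positivity
  have := Real.pi_pos
  have hamgm : 2 * |x| ≤ 2 * v₂ + x ^ 2 / (2 * v₂) := by
    have : 2 * v₂ + x ^ 2 / (2 * v₂) - 2 * |x| = (2 * v₂ - |x|) ^ 2 / (2 * v₂) := by
      field_simp
      rw [← sq_abs x]
      ring
    linarith [show 0 ≤ (2 * v₂ - |x|) ^ 2 / (2 * v₂) by positivity]
  have hexp : Real.exp (-(x - 0) ^ 2 / (2 * v)) ≤ (1 + 2 * v₂) / (1 + |x|) := by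
    calc Real.exp (-(x - 0) ^ 2 / (2 * v))
        ≤ Real.exp (-(x ^ 2 / (2 * v₂))) := by
          rw [Real.exp_le_exp, sub_zero, neg_div, neg_le_neg_iff]
          gcongr
      _ ≤ (1 + x ^ 2 / (2 * v₂))⁻¹ := by
          rw [Real.exp_neg, add_comm]
          gcongr
          exact Real.add_one_le_exp _
      _ ≤ (1 + 2 * v₂) / (1 + |x|) := by
          rw [inv_eq_one_div, div_le_div_iff₀ hpos (by positivity)]
          nlinarith [abs_nonneg x, show 0 ≤ 2 * v₂ * (x ^ 2 / (2 * v₂)) by positivity]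
  rw [gaussianPDFReal, mul_div_assoc]
  gcongr

theorem gaussianReal_relBall_le {v : ℝ≥0} (hv : v ≠ 0) {B : ℝ≥0}
    (hB : ∀ x, gaussianPDFReal 0 v x ≤ B / (1 + |x|)) {t : ℝ≥0} (ht : (t : ℝ) ≤ 1 / 2) (z : ℝ) :
    gaussianReal 0 v (relBall z t) ≤ 8 * B * t := by
  rw [gaussianReal_apply _ hv]
  calc ∫⁻ x in relBall z t, gaussianPDF 0 v x
      ≤ ∫⁻ _ in relBall z t, ENNReal.ofReal (2 * B / (1 + |z|)) := by
        refine setLIntegral_mono' (measurableSet_le (by fun_prop) (by fun_prop)) fun x hx =>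
          ENNReal.ofReal_le_ofReal ((hB x).trans ?_)
        rw [div_le_div_iff₀ (by positivity) (by positivity)]
        nlinarith [one_add_abs_le_of_mem_relBall ht hx, B.2]
    _ ≤ ENNReal.ofReal (2 * B / (1 + |z|)) *
          volume (Metric.closedBall z (2 * t * (1 + |z|))) := by
        rw [setLIntegral_const]
        gcongr
        exact relBall_subset_closedBall ht
    _ = ENNReal.ofReal (8 * B * t) := by
        rw [Real.volume_closedBall, ← ENNReal.ofReal_mul (by positivity)]
        congr 1
        field_simp
        ring
    _ = 8 * B * t := by
        rw [ENNReal.ofReal_mul (by positivity), ENNReal.ofReal_mul (by positivity)]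
        simp

theorem exists_gaussianReal_relBall_le {v₁ : ℝ≥0} (hv₁ : v₁ ≠ 0) (v₂ : ℝ≥0) :
    ∃ C : ℝ≥0, ∀ v ∈ Icc v₁ v₂, ∀ (z : ℝ) (u : ℝ≥0∞),
      gaussianReal 0 v (relBall z u) ≤ C * u := by
  obtain ⟨B, hB⟩ : ∃ B : ℝ≥0, (B : ℝ) = (√(2 * Real.pi * v₁))⁻¹ * (1 + 2 * v₂) :=
    ⟨⟨_, by positivity⟩, rfl⟩
  refine ⟨8 * B + 2, fun v hv z u => ?_⟩
  rcases le_or_gt u (1 / 2) with hu | hu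
  · lift u to ℝ≥0 using (hu.trans_lt (by simp)).ne
    have ht : (u : ℝ) ≤ 1 / 2 := by
      have := ENNReal.toReal_mono (by simp) hu
      simpa using this
    refine (gaussianReal_relBall_le (fun h0 => hv₁ (by simpa [h0] using hv.1))
      (fun x => hB ▸ gaussianPDFReal_le_div_one_add_abs hv₁ hv x) ht z).trans ?_
    push_cast
    gcongr
    exact le_self_add
  · calc gaussianReal 0 v (relBall z u) ≤ 1 := prob_le_one
      _ = 2 * (1 / 2) := (ENNReal.mul_div_cancel (by simp) (by simp)).symm
      _ ≤ ↑(8 * B + 2) * u := by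
        push_cast
        gcongr
        exact le_add_self

theorem IsIsonormal.measure_exists_enorm_sub_le {Ω H ι : Type*} [MeasurableSpace Ω]
    {P : Measure Ω} [NormedAddCommGroup H] [InnerProductSpace ℝ H] {X : H → Ω → ℝ} [Countable ι]
    (hX : IsIsonormal X P) {g : ι → H} {g₀ : H} (hg₀ : g₀ ≠ 0) {C s : ℝ≥0∞}
    (hC : ∀ z u, gaussianReal 0 (‖g₀‖₊ ^ 2) (relBall z u) ≤ C * u)
    (hs : ∀ t, ‖g t - g₀‖ₑ ≤ s) (z : ℝ) :
    P {ω | ∃ t, ‖X (g t) ω - z‖ₑ ≤ s} ≤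
      C * (s + s / ‖g₀‖ₑ + ∫⁻ ω, ⨆ t, ‖X ((ℝ ∙ g₀)ᗮ.starProjection (g t)) ω‖ₑ ∂P) := by
  have := hX.isGaussianProcess.isProbabilityMeasure
  set R : Ω → ℝ≥0∞ := fun ω => ⨆ t, ‖X ((ℝ ∙ g₀)ᗮ.starProjection (g t)) ω‖ₑ
  set U : Ω → ℝ≥0∞ := fun ω => s + s / ‖g₀‖ₑ + R ω
  have hR : AEMeasurable R P := .iSup fun t => (hX.aemeasurable _).enorm
  have hU : AEMeasurable U P := hR.const_add _
  have hindep : IndepFun (X g₀) U P :=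
    (hX.indepFun_iSup_orthogonal fun t => (Submodule.mem_orthogonal_singleton_iff_inner_right).1
      (Submodule.starProjection_apply_mem _ _)).comp (φ := id)
      (ψ := fun y => s + s / ‖g₀‖ₑ + y) measurable_id (by fun_prop)
  have hmeas : MeasurableSet {p : ℝ × ℝ≥0∞ | p.1 ∈ relBall z p.2} := by
    simp only [relBall, mem_ofPred_eq]
    exact measurableSet_le (by fun_prop) (by fun_prop)
  have hnear : ∀ᵐ ω ∂P, (∃ t, ‖X (g t) ω - z‖ₑ ≤ s) → X g₀ ω ∈ relBall z (U ω) := by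
    filter_upwards [ae_all_iff.2 fun t => hX.ae_enorm_sub_le hg₀ (g t)] with ω hω ⟨t, ht⟩
    calc ‖X g₀ ω - z‖ₑ
        = ‖X (g t) ω - z + (X g₀ ω - X (g t) ω)‖ₑ := by ring_nf
      _ ≤ ‖X (g t) ω - z‖ₑ + ‖X g₀ ω - X (g t) ω‖ₑ := enorm_add_le _ _
      _ ≤ s + (s / ‖g₀‖ₑ * ‖X g₀ ω‖ₑ + R ω) := by
          gcongr
          refine (hω t).trans ?_
          gcongr
          exacts [hs t, le_iSup (fun t => ‖X ((ℝ ∙ g₀)ᗮ.starProjection (g t)) ω‖ₑ) t]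
      _ ≤ (s + R ω) * 1 + s / ‖g₀‖ₑ * ‖X g₀ ω‖ₑ := by rw [mul_one]; exact le_of_eq (by ring)
      _ ≤ U ω * 1 + U ω * ‖X g₀ ω‖ₑ := by
          gcongr
          · exact add_le_add_left le_self_add _
          · exact le_add_right le_add_self
      _ = U ω * (1 + ‖X g₀ ω‖ₑ) := by ring
  calc P {ω | ∃ t, ‖X (g t) ω - z‖ₑ ≤ s}
      ≤ P ((fun ω => (X g₀ ω, U ω)) ⁻¹' {p | p.1 ∈ relBall z p.2}) := measure_mono_ae hnear
    _ = ∫⁻ u, gaussianReal 0 (‖g₀‖₊ ^ 2) (relBall z u) ∂P.map U := by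
        rw [← Measure.map_apply_of_aemeasurable ((hX.aemeasurable g₀).prodMk hU) hmeas,
          (indepFun_iff_map_prod_eq_prod_map_map (hX.aemeasurable g₀) hU).1 hindep,
          Measure.prod_apply_symm hmeas, hX.map_eq_gaussianReal]
        rfl
    _ ≤ ∫⁻ u, C * u ∂P.map U := lintegral_mono fun u => hC z u
    _ = C * ∫⁻ ω, U ω ∂P := by
        rw [lintegral_const_mul _ measurable_id', lintegral_map' (by fun_prop) hU]
    _ = _ := by
        rw [lintegral_add_left' (by fun_prop), lintegral_const, measure_univ, mul_one]

section Cube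

variable {k N : ℕ} {a x y : Euc k} {ℓ ℓ' : ℝ≥0}

/-- The half-open cube with lower corner `a` and side `ℓ`. -/
def cube (a : Euc k) (ℓ : ℝ≥0) : Set (Euc k) :=
  {x | ∀ j, x j ∈ Ico (a j) (a j + ℓ)}

/-- The lower corners of the `N ^ k` congruent subcubes of `cube a ℓ`. -/
noncomputable def gridPoint (a : Euc k) (ℓ : ℝ≥0) (N : ℕ) (i : Fin k → Fin N) : Euc k :=
  WithLp.toLp 2 fun j => a j + (i j : ℕ) * (ℓ / N)

theorem cube_mono (h : ℓ ≤ ℓ') : cube a ℓ ⊆ cube a ℓ' :=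
  fun _ hx j => ⟨(hx j).1, (hx j).2.trans_le (by gcongr)⟩

theorem self_mem_cube (a : Euc k) (hℓ : 0 < ℓ) : a ∈ cube a ℓ :=
  fun _ => ⟨le_rfl, lt_add_of_pos_right _ hℓ⟩

theorem edist_le_of_mem_cube (hx : x ∈ cube a ℓ) (hy : y ∈ cube a ℓ) :
    edist x y ≤ NNReal.sqrt k * ℓ := by
  have hsup : edist (WithLp.ofLp x) (WithLp.ofLp y) ≤ ℓ := by
    refine edist_pi_le_iff.2 fun j => ?_
    rw [edist_nndist, ENNReal.coe_le_coe, ← NNReal.coe_le_coe, coe_nndist, Real.dist_eq, abs_le]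
    obtain ⟨hx₁, hx₂⟩ := hx j
    obtain ⟨hy₁, hy₂⟩ := hy j
    constructor <;> linarith
  calc edist x y ≤ _ := PiLp.antilipschitzWith_ofLp 2 _ x y
    _ ≤ NNReal.sqrt k * ℓ := by
      gcongr
      simp [NNReal.sqrt_eq_rpow]

theorem cube_subset_thickening {I : Set (Euc k)} {r : ℝ≥0} (h : NNReal.sqrt k * ℓ < r)
    (hI : (I ∩ cube a ℓ).Nonempty) : cube a ℓ ⊆ Metric.thickening r I := by
  obtain ⟨x, hxI, hx⟩ := hI
  refine fun y hy => (Metric.mem_thickening_iff_exists_edist_lt _ _).2 ⟨x, hxI, ?_⟩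
  rw [ENNReal.ofReal_coe_nnreal]
  exact (edist_le_of_mem_cube hy hx).trans_lt (by exact_mod_cast h)

theorem gridPoint_mem_cube (hℓ : 0 < ℓ) (i : Fin k → Fin N) :
    gridPoint a ℓ N i ∈ cube a ℓ := by
  intro j
  have hN : (0 : ℝ) < N := by exact_mod_cast (i j).pos
  have hi : ((i j : ℕ) : ℝ) < N := by exact_mod_cast (i j).2
  have : (0 : ℝ) < ℓ := hℓ
  refine ⟨le_add_of_nonneg_right (by positivity), add_lt_add_right ?_ (a j)⟩
  calc ((i j : ℕ) : ℝ) * (ℓ / N) < N * (ℓ / N) := by gcongr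
    _ = ℓ := by field_simp

theorem gridPoint_of_eq_one (hN : N = 1) (i : Fin k → Fin N) : gridPoint a ℓ N i = a := by
  subst hN
  ext j
  simp [gridPoint]

theorem exists_mem_cube_gridPoint (hN : N ≠ 0) (hx : x ∈ cube a ℓ) :
    ∃ i, x ∈ cube (gridPoint a ℓ N i) (ℓ / N) := by
  have hpos : Fin k → (0 : ℝ) < ℓ / N := fun j => by
    have hℓ : (0 : ℝ) < ℓ := by linarith [(hx j).1, (hx j).2]
    positivity
  have hfloor : ∀ j, ⌊(x j - a j) / (ℓ / N)⌋₊ < N := fun j => by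
    rw [Nat.floor_lt (div_nonneg (sub_nonneg.2 (hx j).1) (hpos j).le),
      div_lt_iff₀ (hpos j), mul_div_cancel₀ _ (by positivity)]
    linarith [(hx j).2]
  refine ⟨fun j => ⟨_, hfloor j⟩, fun j => ?_⟩
  have h₁ := (le_div_iff₀ (hpos j)).1 <|
    Nat.floor_le (div_nonneg (sub_nonneg.2 (hx j).1) (hpos j).le)
  have h₂ := (div_lt_iff₀ (hpos j)).1 <| Nat.lt_floor_add_one ((x j - a j) / (ℓ / N))
  simp only [gridPoint, NNReal.coe_div, NNReal.coe_natCast]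
  constructor <;> linarith

theorem exists_edist_gridPoint_le (hN : N ≠ 0) (hℓ : 0 < ℓ) (hx : x ∈ cube a ℓ) :
    ∃ i, edist x (gridPoint a ℓ N i) ≤ NNReal.sqrt k * (ℓ / N : ℝ≥0) := by
  obtain ⟨i, hi⟩ := exists_mem_cube_gridPoint hN hx
  exact ⟨i, edist_le_of_mem_cube hi (self_mem_cube _ (by positivity))⟩

theorem cube_subset_closure_range_gridPoint (hℓ : 0 < ℓ) :
    cube a ℓ ⊆ closure (range fun p : Σ n, Fin k → Fin (2 ^ n) => gridPoint a ℓ (2 ^ p.1) p.2) := by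
  intro x hx
  choose i hi using fun n => exists_edist_gridPoint_le (N := 2 ^ n) (by positivity) hℓ hx
  refine mem_closure_of_tendsto (f := fun n => gridPoint a ℓ (2 ^ n) (i n)) (b := atTop)
    (tendsto_iff_edist_tendsto_0.2 ?_)
    (.of_forall fun n => mem_range_self (⟨n, i n⟩ : Σ n, Fin k → Fin (2 ^ n)))
  have hlim : Tendsto (fun n : ℕ => NNReal.sqrt k * (ℓ / (2 ^ n : ℕ))) atTop (𝓝 0) := by
    have hgeom := (NNReal.tendsto_pow_atTop_nhds_zero_of_lt_one
      (inv_lt_one_of_one_lt₀ one_lt_two)).const_mul (NNReal.sqrt k * ℓ)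
    simpa [mul_assoc, div_eq_mul_inv] using hgeom
  exact tendsto_of_tendsto_of_tendsto_of_le_of_le tendsto_const_nhds
    (ENNReal.tendsto_coe.2 hlim) (fun _ => zero_le) fun n => by
      simpa [edist_comm, ENNReal.coe_mul] using hi n

theorem exists_finset_cube_cover {K : Set (Euc k)} (hK : Bornology.IsBounded K) :
    ∃ M : ℝ≥0, ∀ δ : ℝ≥0, 0 < δ → δ ≤ 1 →
      ∃ J : Finset (Euc k), (J.card : ℝ≥0) ≤ M * δ⁻¹ ^ k ∧ K ⊆ ⋃ a ∈ J, cube a δ := by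
  classical
  obtain ⟨R, hR0, hR⟩ := hK.exists_pos_norm_le
  lift R to ℝ≥0 using hR0.le
  set a : Euc k := WithLp.toLp 2 fun _ => -R
  refine ⟨(2 * (R + 1) + 1) ^ k, fun δ hδ hδ1 => ?_⟩
  set ℓ : ℝ≥0 := 2 * (R + 1)
  set N := ⌈ℓ / δ⌉₊
  have hN : (ℓ / δ) ≤ N := Nat.le_ceil _
  have hN0 : 0 < N := Nat.ceil_pos.2 (by positivity)
  have hside : ℓ / N ≤ δ := by
    rw [div_le_iff₀ (by exact_mod_cast hN0), mul_comm]
    exact (div_le_iff₀ hδ).1 hN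
  refine ⟨Finset.univ.image (gridPoint a ℓ N), ?_, fun x hx => ?_⟩
  · calc ((Finset.univ.image (gridPoint a ℓ N)).card : ℝ≥0)
        ≤ (Fintype.card (Fin k → Fin N) : ℝ≥0) := by exact_mod_cast Finset.card_image_le
      _ = (N : ℝ≥0) ^ k := by simp
      _ ≤ (ℓ / δ + 1 / δ) ^ k := by
          gcongr
          refine (Nat.ceil_lt_add_one (by positivity)).le.trans ?_
          gcongr
          exact (one_le_div hδ).2 hδ1
      _ = (ℓ + 1) ^ k * δ⁻¹ ^ k := by rw [← add_div, div_eq_mul_inv, mul_pow]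
  · have hxcube : x ∈ cube a ℓ := fun j => by
      have hj := abs_le.1 ((PiLp.norm_apply_le x j).trans (hR x hx))
      simp only [a, ℓ]
      push_cast
      constructor <;> linarith
    obtain ⟨i, hi⟩ := exists_mem_cube_gridPoint hN0.ne' hxcube
    exact mem_biUnion (Finset.mem_coe.2 (Finset.mem_image_of_mem _ (Finset.mem_univ i)))
      (cube_mono hside hi)

end Cube

theorem measure_forall_exists_enorm_sub_le_pow {Ω H ι : Type*} [MeasurableSpace Ω]
    [Countable ι] {d : ℕ} {P : Measure Ω} {X : Fin d → H → Ω → ℝ}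
    (hX : iIndepFun (fun i ω h => X i h ω) P) (g : ι → H)
    {p ε : ℝ≥0∞} (hp : ∀ i z, P {ω | ∃ t, ‖X i (g t) ω - z‖ₑ ≤ ε} ≤ p) (z : Fin d → ℝ) :
    P {ω | ∀ i, ∃ t, ‖X i (g t) ω - z i‖ₑ ≤ ε} ≤ p ^ d := by
  let S : Fin d → Set (H → ℝ) := fun i => {y | ∃ t, ‖y (g t) - z i‖ₑ ≤ ε}
  have hS : ∀ i, MeasurableSet (S i) := fun i => by
    simp only [S, ofPred_exists]
    exact .iUnion fun t => measurableSet_le (by fun_prop) measurable_const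
  calc P {ω | ∀ i, ∃ t, ‖X i (g t) ω - z i‖ₑ ≤ ε}
      = P (⋂ i ∈ Finset.univ, (fun ω h => X i h ω) ⁻¹' S i) := by
        congr 1
        ext ω
        simp [S]
    _ = ∏ i, P {ω | ∃ t, ‖X i (g t) ω - z i‖ₑ ≤ ε} :=
        hX.measure_inter_preimage_eq_mul Finset.univ fun i _ => hS i
    _ ≤ p ^ d := by
        simpa using Finset.prod_le_prod' fun i (_ : i ∈ Finset.univ) => hp i (z i)

section Holder

variable {H : Type*} [NormedAddCommGroup H] [InnerProductSpace ℝ H] {k d : ℕ} {g : Euc k → H}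
  {K : Set (Euc k)} {L ξ : ℝ≥0} {a : Euc k} {δ : ℝ≥0}

namespace IsIsonormal

variable {Ω : Type*} [MeasurableSpace Ω] {P : Measure Ω} {X : H → Ω → ℝ}

theorem lintegral_iSup_enorm_gridPoint_le (hX : IsIsonormal X P) (hξ : 0 < ξ) (hδ : 0 < δ)
    (hg : HolderOnWith L ξ g (cube a δ)) (ha : g a = 0) :
    ∫⁻ ω, ⨆ p : Σ n, Fin k → Fin (2 ^ n), ‖X (g (gridPoint a δ (2 ^ p.1) p.2)) ω‖ₑ ∂P ≤
      chainingConst (2 ^ (-(ξ / 2) : ℝ)) (2 * k / ξ + 1) *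
        (L * (NNReal.sqrt k * δ) ^ (ξ : ℝ)) := by
  -- Increments at scale `2 ^ (-n)` are `O((2 ^ (-n)) ^ ξ) = O(θ ^ (2 * n))` for `θ = 2 ^ (-ξ / 2)`,
  -- and `q = 2 * k / ξ + 1` makes the `2 ^ (n * k)` grid points at most `θ ^ (-n * q)` many.
  have hξ' : (0 : ℝ) < ξ := hξ
  choose π hπ using fun n (i : Fin k → Fin (2 ^ (n + 1))) =>
    exists_edist_gridPoint_le (N := 2 ^ n) (by positivity) hδ (gridPoint_mem_cube (a := a) hδ i)
  refine hX.lintegral_iSup_enorm_chain_le (π := π)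
    (h := fun n i => g (gridPoint a δ (2 ^ n) i)) (by simp) (by simp) le_add_self (fun n => ?_)
    (fun i => by rw [gridPoint_of_eq_one (pow_zero 2), ha]) fun n i => ?_
  · calc (Fintype.card (Fin k → Fin (2 ^ n)) : ℝ≥0∞)
        = 2 ^ (n * k : ℝ) := by
          rw [Fintype.card_fun, Fintype.card_fin, Fintype.card_fin, ← pow_mul]
          exact_mod_cast (ENNReal.rpow_natCast 2 (n * k)).symm
      _ ≤ 2 ^ (ξ / 2 * (n * (2 * k / ξ + 1)) : ℝ) := by
          refine ENNReal.rpow_le_rpow_of_exponent_le one_le_two ?_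
          have : (ξ / 2 * (n * (2 * k / ξ + 1)) : ℝ) = n * k + ξ / 2 * n := by field_simp
          rw [this]
          exact le_add_of_nonneg_right (by positivity)
      _ = _ := by
          rw [← ENNReal.rpow_neg, neg_neg, ← ENNReal.rpow_natCast, ← ENNReal.rpow_mul,
            ← ENNReal.rpow_mul]
          push_cast
          rfl
  · calc ‖g (gridPoint a δ (2 ^ (n + 1)) i) - g (gridPoint a δ (2 ^ n) (π n i))‖ₑ
        ≤ L * (NNReal.sqrt k * (δ / (2 ^ n : ℕ) : ℝ≥0)) ^ (ξ : ℝ) := by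
          rw [← edist_eq_enorm_sub]
          exact hg.edist_le_of_le (gridPoint_mem_cube hδ i) (gridPoint_mem_cube hδ _) (hπ n i)
      _ = L * ((NNReal.sqrt k * δ) * 2 ^ (-n : ℝ)) ^ (ξ : ℝ) := by
          rw [ENNReal.coe_div (by positivity), ENNReal.rpow_neg, ENNReal.rpow_natCast,
            div_eq_mul_inv, mul_assoc]
          push_cast
          rfl
      _ = L * (NNReal.sqrt k * δ) ^ (ξ : ℝ) * (2 ^ (-(ξ / 2) : ℝ)) ^ (2 * n) := by
          rw [ENNReal.mul_rpow_of_nonneg _ _ hξ'.le, mul_assoc, ← ENNReal.rpow_mul,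
            ← ENNReal.rpow_natCast _ (2 * n), ← ENNReal.rpow_mul]
          congr 3
          push_cast
          ring

theorem measure_exists_gridPoint_le (hX : IsIsonormal X P) (hξ : 0 < ξ) (hδ : 0 < δ)
    (hg : HolderOnWith L ξ g (cube a δ)) (ha : g a ≠ 0) {C : ℝ≥0∞}
    (hC : ∀ z u, gaussianReal 0 (‖g a‖₊ ^ 2) (relBall z u) ≤ C * u) (z : ℝ) :
    P {ω | ∃ p : Σ n, Fin k → Fin (2 ^ n),
      ‖X (g (gridPoint a δ (2 ^ p.1) p.2)) ω - z‖ₑ ≤ 2 * δ ^ (ξ : ℝ)} ≤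
      C * (1 + ‖g a‖ₑ⁻¹ + chainingConst (2 ^ (-(ξ / 2) : ℝ)) (2 * k / ξ + 1)) *
        (L * NNReal.sqrt k ^ (ξ : ℝ) + 2) * δ ^ (ξ : ℝ) := by
  set c := chainingConst (2 ^ (-(ξ / 2) : ℝ)) (2 * k / ξ + 1)
  set s : ℝ≥0∞ := (L * NNReal.sqrt k ^ (ξ : ℝ) + 2) * δ ^ (ξ : ℝ)
  have hs : L * (NNReal.sqrt k * δ) ^ (ξ : ℝ) ≤ s := by
    rw [ENNReal.mul_rpow_of_nonneg _ _ ξ.coe_nonneg, ← mul_assoc]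
    exact mul_le_mul' le_self_add le_rfl
  have hproj : HolderOnWith L ξ (fun x => (ℝ ∙ g a)ᗮ.starProjection (g x)) (cube a δ) :=
    fun x hx y hy => by
      refine le_trans ?_ (hg x hx y hy)
      rw [edist_eq_enorm_sub, edist_eq_enorm_sub, ← map_sub, enorm_le_iff_norm_le]
      exact Submodule.norm_starProjection_apply_le _ _
  calc P {ω | ∃ p : Σ n, Fin k → Fin (2 ^ n),
        ‖X (g (gridPoint a δ (2 ^ p.1) p.2)) ω - z‖ₑ ≤ 2 * δ ^ (ξ : ℝ)}
      ≤ P {ω | ∃ p : Σ n, Fin k → Fin (2 ^ n),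
          ‖X (g (gridPoint a δ (2 ^ p.1) p.2)) ω - z‖ₑ ≤ s} :=
        measure_mono fun ω ⟨p, hp⟩ => ⟨p, hp.trans (mul_le_mul' le_add_self le_rfl)⟩
    _ ≤ C * (s + s / ‖g a‖ₑ + c * s) := by
        refine (hX.measure_exists_enorm_sub_le ha hC (fun p => ?_) z).trans ?_
        · rw [← edist_eq_enorm_sub]
          exact (hg.edist_le_of_le (gridPoint_mem_cube hδ _) (self_mem_cube a hδ)
            (edist_le_of_mem_cube (gridPoint_mem_cube hδ _) (self_mem_cube a hδ))).trans hs
        · gcongr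
          refine (hX.lintegral_iSup_enorm_gridPoint_le hξ hδ hproj
            (Submodule.starProjection_orthogonalComplement_singleton_eq_zero _)).trans ?_
          gcongr
    _ = _ := by
        rw [div_eq_mul_inv]
        ring

end IsIsonormal

theorem exists_measure_exists_gridPoint_le (hK : IsCompact K) (hξ : 0 < ξ)
    (hg : HolderOnWith L ξ g K) (hg0 : ∀ x ∈ K, g x ≠ 0) :
    ∃ B : ℝ≥0, ∀ {Ω : Type*} [MeasurableSpace Ω] {P : Measure Ω} {X : H → Ω → ℝ},
      IsIsonormal X P → ∀ {a δ}, 0 < δ → cube a δ ⊆ K → ∀ z : ℝ,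
        P {ω | ∃ p : Σ n, Fin k → Fin (2 ^ n),
          ‖X (g (gridPoint a δ (2 ^ p.1) p.2)) ω - z‖ₑ ≤ 2 * δ ^ (ξ : ℝ)} ≤
          B * δ ^ (ξ : ℝ) := by
  obtain ⟨σ₁, σ₂, hσ₁, hσ⟩ : ∃ σ₁ σ₂ : ℝ≥0, 0 < σ₁ ∧ ∀ x ∈ K, ‖g x‖₊ ∈ Icc σ₁ σ₂ := by
    have hcont : ContinuousOn (fun x => ‖g x‖₊) K := (hg.continuousOn hξ).nnnorm
    obtain ⟨σ₁, hσ₁, h₁⟩ := hK.exists_forall_le' hcont fun x hx => nnnorm_pos.2 (hg0 x hx)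
    obtain ⟨σ₂, h₂⟩ := hK.bddAbove_image hcont
    exact ⟨σ₁, σ₂, hσ₁, fun x hx => ⟨h₁ x hx, h₂ (mem_image_of_mem _ hx)⟩⟩
  obtain ⟨C, hC⟩ := exists_gaussianReal_relBall_le (pow_pos hσ₁ 2).ne' (σ₂ ^ 2)
  obtain ⟨c, hc⟩ : ∃ c : ℝ≥0, (c : ℝ≥0∞) =
      chainingConst (2 ^ (-(ξ / 2) : ℝ)) (2 * k / ξ + 1) :=
    ⟨_, ENNReal.coe_toNNReal <| chainingConst_ne_top (by simp)
      (ENNReal.rpow_lt_one_of_one_lt_of_neg ENNReal.one_lt_two (by simpa using hξ)) _⟩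
  refine ⟨C * (1 + σ₁⁻¹ + c) * (L * NNReal.sqrt k ^ (ξ : ℝ) + 2),
    fun hX a δ hδ haK z => ?_⟩
  have ha : a ∈ K := haK (self_mem_cube a hδ)
  obtain ⟨ha₁, ha₂⟩ := hσ a ha
  refine (hX.measure_exists_gridPoint_le hξ hδ (hg.mono haK) (hg0 a ha) (C := C)
    (hC _ ⟨by gcongr, by gcongr⟩) z).trans ?_
  rw [← hc]
  push_cast
  rw [ENNReal.coe_inv hσ₁.ne', ENNReal.coe_rpow_of_nonneg _ ξ.coe_nonneg]
  gcongr
  exact_mod_cast ha₁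

/-- A random field on `K ⊆ ℝ^k` with values in `ℝ^d` and almost surely continuous paths, whose
independent components are `X i (g x)` for isonormal processes `X i` and a deterministic `g`. -/
structure IsIsonormalField {Ω : Type*} [MeasurableSpace Ω] (X : Fin d → H → Ω → ℝ) (g : Euc k → H)
    (K : Set (Euc k)) (v : Euc k → Ω → Euc d) (P : Measure Ω) : Prop where
  isIsonormal : ∀ i, IsIsonormal (X i) P
  iIndepFun : iIndepFun (fun i ω h => X i h ω) P
  ae_eq : ∀ x ∈ K, ∀ i, (fun ω => v x ω i) =ᵐ[P] X i (g x)
  ae_continuousOn : ∀ᵐ ω ∂P, ContinuousOn (fun x => v x ω) K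

theorem IsIsonormalField.measure_image_cube_inter_closedEBall_le {Ω : Type*} [MeasurableSpace Ω]
    {P : Measure Ω} {X : Fin d → H → Ω → ℝ} {v : Euc k → Ω → Euc d}
    (hv : IsIsonormalField X g K v P) (hδ : 0 < δ) (haK : cube a δ ⊆ K) {p : ℝ≥0∞} {ε : ℝ≥0}
    (hε : 0 < ε)
    (hp : ∀ i (z : ℝ), P {ω | ∃ t : Σ n, Fin k → Fin (2 ^ n),
      ‖X i (g (gridPoint a δ (2 ^ t.1) t.2)) ω - z‖ₑ ≤ 2 * ε} ≤ p) (z : Euc d) :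
    P {ω | ((fun x => v x ω) '' cube a δ ∩ Metric.closedEBall z ε).Nonempty} ≤ p ^ d := by
  have hgrid : ∀ t : Σ n, Fin k → Fin (2 ^ n), gridPoint a δ (2 ^ t.1) t.2 ∈ cube a δ :=
    fun t => gridPoint_mem_cube hδ t.2
  have hae : ∀ᵐ ω ∂P, ∀ (t : Σ n, Fin k → Fin (2 ^ n)) i,
      v (gridPoint a δ (2 ^ t.1) t.2) ω i = X i (g (gridPoint a δ (2 ^ t.1) t.2)) ω := by
    simp_rw [ae_all_iff]
    exact fun t i => hv.ae_eq _ (haK (hgrid t)) i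
  refine (measure_mono_ae ?_).trans <| measure_forall_exists_enorm_sub_le_pow hv.iIndepFun
    (fun t : Σ n, Fin k → Fin (2 ^ n) => g (gridPoint a δ (2 ^ t.1) t.2)) hp z.ofLp
  filter_upwards [hae, hv.ae_continuousOn] with ω hω hcont
  rintro ⟨_, ⟨x, hx, rfl⟩, hxz⟩
  have hclosure : v x ω ∈ closure ((fun x => v x ω) ''
      range fun t : Σ n, Fin k → Fin (2 ^ n) => gridPoint a δ (2 ^ t.1) t.2) :=
    ((hcont x (haK hx)).mono (range_subset_iff.2 fun t => haK (hgrid t))).mem_closure_image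
      (cube_subset_closure_range_gridPoint hδ hx)
  obtain ⟨_, ⟨_, ⟨t, rfl⟩, rfl⟩, ht⟩ :=
    EMetric.mem_closure_iff.1 hclosure ε (by exact_mod_cast hε)
  refine fun i => ⟨t, ?_⟩
  rw [← hω t i, ← edist_eq_enorm_sub]
  calc edist (v (gridPoint a δ (2 ^ t.1) t.2) ω i) (z i)
      ≤ edist (v (gridPoint a δ (2 ^ t.1) t.2) ω) z := PiLp.edist_apply_le _ _ i
    _ ≤ edist (v x ω) (v (gridPoint a δ (2 ^ t.1) t.2) ω) + edist (v x ω) z :=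
        edist_triangle_left _ _ _
    _ ≤ 2 * ε := by
        rw [two_mul]
        exact add_le_add ht.le hxz

theorem measure_image_inter_closedEBall_le_of_cube {Ω : Type*} [MeasurableSpace Ω] {P : Measure Ω}
    {v : Euc k → Ω → Euc d} {I : Set (Euc k)} {B M : ℝ≥0} (hξ : 0 < ξ) (hδ : 0 < δ) {z : Euc d}
    (hcube : ∀ a, (I ∩ cube a δ).Nonempty →
      P {ω | ((fun x => v x ω) '' cube a δ ∩ Metric.closedEBall z (δ ^ (ξ : ℝ))).Nonempty} ≤
        (B * δ ^ (ξ : ℝ)) ^ d) {J : Finset (Euc k)} (hJ : (J.card : ℝ≥0) ≤ M * δ⁻¹ ^ k)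
    (hIJ : I ⊆ ⋃ a ∈ J, cube a δ) :
    P {ω | ((fun x => v x ω) '' I ∩ Metric.closedEBall z (δ ^ (ξ : ℝ))).Nonempty} ≤
      M * B ^ d * ((δ : ℝ≥0∞) ^ (ξ : ℝ)) ^ ((d : ℝ) - k / ξ) := by
  have hδ' : (δ : ℝ≥0∞) ≠ 0 := by exact_mod_cast hδ.ne'
  set S : Euc k → Set Ω := fun a =>
    {ω | ((fun x => v x ω) '' (I ∩ cube a δ) ∩ Metric.closedEBall z (δ ^ (ξ : ℝ))).Nonempty}
  have hcover : {ω | ((fun x => v x ω) '' I ∩ Metric.closedEBall z (δ ^ (ξ : ℝ))).Nonempty} ⊆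
      ⋃ a ∈ J, S a := by
    rintro ω ⟨_, ⟨x, hxI, rfl⟩, hxz⟩
    obtain ⟨a, haJ, hxa⟩ := mem_iUnion₂.1 (hIJ hxI)
    exact mem_biUnion haJ ⟨_, ⟨x, ⟨hxI, hxa⟩, rfl⟩, hxz⟩
  have hS : ∀ a ∈ J, P (S a) ≤ (B * δ ^ (ξ : ℝ)) ^ d := fun a _ => by
    rcases (I ∩ cube a δ).eq_empty_or_nonempty with ha | ha
    · simp [S, ha]
    · exact (measure_mono fun ω => Nonempty.mono <| inter_subset_inter_left _ <|
        image_mono inter_subset_right).trans (hcube a ha)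
  calc P {ω | ((fun x => v x ω) '' I ∩ Metric.closedEBall z (δ ^ (ξ : ℝ))).Nonempty}
      ≤ ∑ a ∈ J, P (S a) := (measure_mono hcover).trans (measure_biUnion_finset_le _ _)
    _ ≤ ((J.card : ℝ≥0) : ℝ≥0∞) * (B * δ ^ (ξ : ℝ)) ^ d := by
        simpa using Finset.sum_le_card_nsmul _ _ _ hS
    _ ≤ ((M * δ⁻¹ ^ k : ℝ≥0) : ℝ≥0∞) * (B * δ ^ (ξ : ℝ)) ^ d := by gcongr
    _ = M * B ^ d * (((δ : ℝ≥0∞) ^ (ξ : ℝ)) ^ (d : ℝ) * ((δ : ℝ≥0∞) ^ (k : ℝ))⁻¹) := by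
        push_cast
        rw [ENNReal.coe_inv hδ.ne', ← ENNReal.inv_pow, ENNReal.rpow_natCast, ENNReal.rpow_natCast]
        ring
    _ = M * B ^ d * ((δ : ℝ≥0∞) ^ (ξ : ℝ)) ^ ((d : ℝ) - k / ξ) := by
        rw [ENNReal.rpow_sub _ _ (by simp [hδ']) (by simp),
          ← ENNReal.rpow_mul (y := (ξ : ℝ)) _ (k / ξ),
          mul_div_cancel₀ _ (by exact_mod_cast hξ.ne'), div_eq_mul_inv]

theorem exists_measure_image_inter_nonempty_le (d : ℕ) (hK : IsCompact K) (hξ : 0 < ξ)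
    (hg : HolderOnWith L ξ g K) (hg0 : ∀ x ∈ K, g x ≠ 0) {r : ℝ} (hr : 0 < r) :
    ∃ C : ℝ≥0, 0 < C ∧ ∀ {Ω : Type*} [MeasurableSpace Ω] {P : Measure Ω} {X : Fin d → H → Ω → ℝ}
      {v : Euc k → Ω → Euc d}, IsIsonormalField X g K v P →
      ∀ I : Set (Euc k), Metric.thickening r I ⊆ K → ∀ A : Set (Euc d),
        P {ω | ((fun x => v x ω) '' I ∩ A).Nonempty} ≤ C * μH[(d : ℝ) - k / ξ] A := by
  obtain ⟨B, hB⟩ := exists_measure_exists_gridPoint_le hK hξ hg hg0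
  obtain ⟨M, hM⟩ := exists_finset_cube_cover hK.isBounded
  lift r to ℝ≥0 using hr.le
  set δ₀ : ℝ≥0 := min 1 (r / (NNReal.sqrt k + 1))
  have hδ₀ : 0 < δ₀ := lt_min one_pos (div_pos (NNReal.coe_pos.1 hr) (by positivity))
  refine ⟨M * B ^ d + 1, by positivity, fun {Ω _ P X v} hv I hI A => ?_⟩
  refine measure_inter_nonempty_le_hausdorffMeasure_of_closedEBall (r := δ₀ ^ (ξ : ℝ))
    (by simp) ENNReal.coe_ne_top (NNReal.rpow_pos hδ₀) (fun z ε hε hεr => ?_) A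
  lift ε to ℝ≥0 using (hεr.trans_lt ENNReal.coe_lt_top).ne
  obtain ⟨δ, rfl⟩ : ∃ δ : ℝ≥0, δ ^ (ξ : ℝ) = ε :=
    ⟨ε ^ (ξ : ℝ)⁻¹, NNReal.rpow_inv_rpow (by exact_mod_cast hξ.ne') ε⟩
  have hδ : 0 < δ := by
    refine pos_iff_ne_zero.2 fun h0 => hε.ne' ?_
    simp [h0, hξ.ne']
  have hδle : δ ≤ δ₀ :=
    (NNReal.rpow_le_rpow_iff (by exact_mod_cast hξ)).1 (by exact_mod_cast hεr)
  have hdiam : NNReal.sqrt k * δ < r :=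
    calc NNReal.sqrt k * δ < (NNReal.sqrt k + 1) * δ := by gcongr; exact lt_add_one _
      _ ≤ r := (le_div_iff₀' (by positivity)).1 (hδle.trans (min_le_right _ _))
  have hcube : ∀ a, (I ∩ cube a δ).Nonempty → cube a δ ⊆ K :=
    fun a ha => (cube_subset_thickening hdiam ha).trans hI
  obtain ⟨J, hJcard, hJ⟩ := hM δ hδ (hδle.trans (min_le_left _ _))
  rw [ENNReal.coe_rpow_of_nonneg _ ξ.coe_nonneg]
  refine (measure_image_inter_closedEBall_le_of_cube (B := B) hξ hδ (fun a ha => ?_)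
    hJcard (((Metric.self_subset_thickening hr I).trans hI).trans hJ)).trans ?_
  · have := hv.measure_image_cube_inter_closedEBall_le hδ (hcube a ha) (NNReal.rpow_pos hδ)
      (fun i z => by
        rw [ENNReal.coe_rpow_of_nonneg _ ξ.coe_nonneg]
        exact hB (hv.isIsonormal i) hδ (hcube a ha) z) z
    rwa [ENNReal.coe_rpow_of_nonneg _ ξ.coe_nonneg] at this
  · push_cast
    gcongr
    exact le_self_add

end Holder

section HolderLp

variable {X S : Type*} [PseudoEMetricSpace X] [MeasurableSpace S] {μ : Measure S} {p : ℝ≥0∞}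
  {r s : ℝ≥0} {f g : X → S → ℝ} {K : Set X}

/-- `x ↦ f x` is `r`-Hölder continuous on `K` for the `L^p(μ)` seminorm; stated for functions rather
than for their classes in `Lp`, so that `f x` may be modified or split up freely. -/
def IsHolderLpOn (p : ℝ≥0∞) (r : ℝ≥0) (f : X → S → ℝ) (K : Set X) (μ : Measure S) : Prop :=
  ∃ C : ℝ≥0, ∀ x ∈ K, ∀ x' ∈ K, eLpNorm (f x - f x') p μ ≤ C * edist x x' ^ (r : ℝ)

namespace IsHolderLpOn

theorem mono {K' : Set X} (hf : IsHolderLpOn p r f K μ) (h : K' ⊆ K) : IsHolderLpOn p r f K' μ :=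
  let ⟨C, hC⟩ := hf
  ⟨C, fun x hx x' hx' => hC x (h hx) x' (h hx')⟩

theorem sub (hp : 1 ≤ p) (hf : IsHolderLpOn p r f K μ) (hg : IsHolderLpOn p r g K μ)
    (hfm : ∀ x ∈ K, AEStronglyMeasurable (f x) μ) (hgm : ∀ x ∈ K, AEStronglyMeasurable (g x) μ) :
    IsHolderLpOn p r (f - g) K μ := by
  obtain ⟨C, hC⟩ := hf
  obtain ⟨C', hC'⟩ := hg
  refine ⟨C + C', fun x hx x' hx' => ?_⟩
  calc eLpNorm ((f - g) x - (f - g) x') p μ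
      = eLpNorm ((f x - f x') - (g x - g x')) p μ := by
        rw [Pi.sub_apply, Pi.sub_apply, sub_sub_sub_comm]
    _ ≤ eLpNorm (f x - f x') p μ + eLpNorm (g x - g x') p μ :=
        eLpNorm_sub_le ((hfm x hx).sub (hfm x' hx')) ((hgm x hx).sub (hgm x' hx')) hp
    _ ≤ C * edist x x' ^ (r : ℝ) + C' * edist x x' ^ (r : ℝ) :=
        add_le_add (hC x hx x' hx') (hC' x hx x' hx')
    _ = _ := by rw [ENNReal.coe_add, add_mul]

theorem of_le (hf : IsHolderLpOn p s f K μ) (hK : Metric.ediam K ≠ ∞) (hrs : r ≤ s) :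
    IsHolderLpOn p r f K μ := by
  obtain ⟨C, hC⟩ := hf
  have hsr : (0 : ℝ) ≤ s - r := sub_nonneg.2 hrs
  lift Metric.ediam K ^ ((s : ℝ) - r) to ℝ≥0 using ENNReal.rpow_ne_top_of_nonneg hsr hK with B hB
  refine ⟨C * B, fun x hx x' hx' => (hC x hx x' hx').trans ?_⟩
  calc (C : ℝ≥0∞) * edist x x' ^ (s : ℝ)
      = C * (edist x x' ^ ((s : ℝ) - r) * edist x x' ^ (r : ℝ)) := by
        rw [← ENNReal.rpow_add_of_nonneg _ _ hsr r.coe_nonneg, sub_add_cancel]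
    _ ≤ C * (Metric.ediam K ^ ((s : ℝ) - r) * edist x x' ^ (r : ℝ)) := by
        gcongr
        exact Metric.edist_le_ediam_of_mem hx hx'
    _ = _ := by rw [← hB, ENNReal.coe_mul, mul_assoc]

theorem of_ae_lipschitzOnWith [IsFiniteMeasure μ] {L : ℝ≥0}
    (h : ∀ᵐ y ∂μ, LipschitzOnWith L (fun x => f x y) K) : IsHolderLpOn p 1 f K μ := by
  have hμ : μ univ ^ p.toReal⁻¹ ≠ ∞ :=
    ENNReal.rpow_ne_top_of_nonneg (by positivity) (measure_ne_top _ _)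
  lift μ univ ^ p.toReal⁻¹ to ℝ≥0 using hμ with V hV
  refine ⟨V * L, fun x hx x' hx' => ?_⟩
  have hbound : ∀ᵐ y ∂μ, ‖(f x - f x') y‖ₑ ≤ L * edist x x' := by
    filter_upwards [h] with y hy
    simpa [edist_eq_enorm_sub] using hy hx hx'
  calc eLpNorm (f x - f x') p μ ≤ (L * edist x x') • μ univ ^ p.toReal⁻¹ :=
        eLpNorm_le_of_ae_enorm_bound hbound
    _ = _ := by
        rw [← hV, ENNReal.coe_mul, NNReal.coe_one, ENNReal.rpow_one, smul_eq_mul]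
        ring

theorem exists_holderOnWith_toLp [Fact (1 ≤ p)] (hf : IsHolderLpOn p r f K μ) {F : X → Lp ℝ p μ}
    (hF : ∀ x ∈ K, F x =ᵐ[μ] f x) : ∃ C : ℝ≥0, HolderOnWith C r F K := by
  obtain ⟨C, hC⟩ := hf
  refine ⟨C, fun x hx x' hx' => ?_⟩
  rw [Lp.edist_def, eLpNorm_congr_ae ((hF x hx).sub (hF x' hx'))]
  exact hC x hx x' hx'

end IsHolderLpOn

end HolderLp

section Translate

variable {G : Type*} [SubtractionMonoid G] [MeasurableSpace G] [MeasurableAdd G] [MeasurableNeg G]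
  {μ : Measure G} [μ.IsAddLeftInvariant] [μ.IsNegInvariant] {p : ℝ≥0∞} {F : G → ℝ}

theorem eLpNorm_comp_sub_left_restrict_le (hF : Measurable F) (x : G) (s : Set G) :
    eLpNorm (fun y => F (x - y)) p (μ.restrict s) ≤ eLpNorm F p μ :=
  (eLpNorm_mono_measure _ Measure.restrict_le_self).trans_eq <|
    eLpNorm_comp_measurePreserving hF.aestronglyMeasurable
      (Measure.measurePreserving_sub_left μ x)

theorem eLpNorm_restrict_le_two_mul_of_ae_le_comp_sub_left (hF : Measurable F) (hp : 1 ≤ p)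
    {s : Set G} {f : G → ℝ} {x x' : G}
    (h : ∀ᵐ y ∂μ.restrict s, |f y| ≤ F (x - y) + F (x' - y)) :
    eLpNorm f p (μ.restrict s) ≤ 2 * eLpNorm F p μ := by
  have hm (z : G) : AEStronglyMeasurable (fun y => F (z - y)) (μ.restrict s) :=
    (hF.comp (Measure.measurePreserving_sub_left μ z).measurable).aestronglyMeasurable
  calc eLpNorm f p (μ.restrict s)
      ≤ eLpNorm ((fun y => F (x - y)) + fun y => F (x' - y)) p (μ.restrict s) :=
        eLpNorm_mono_ae_real h
    _ ≤ eLpNorm F p μ + eLpNorm F p μ :=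
        (eLpNorm_add_le (hm x) (hm x') hp).trans <| add_le_add
          (eLpNorm_comp_sub_left_restrict_le hF x s) (eLpNorm_comp_sub_left_restrict_le hF x' s)
    _ = 2 * eLpNorm F p μ := (two_mul _).symm

end Translate

section Pointwise

variable {a b h β : ℝ}

theorem log_one_add_le_inv_mul_rpow {u : ℝ} (hu : 0 ≤ u) (hβ0 : 0 < β) (hβ1 : β ≤ 1) :
    Real.log (1 + u) ≤ β⁻¹ * u ^ β := by
  have hsub : (1 + u) ^ β ≤ 1 + u ^ β := by
    simpa using Real.rpow_add_le_add_rpow zero_le_one hu hβ0.le hβ1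
  have hlog : β * Real.log (1 + u) ≤ u ^ β := by
    rw [← Real.log_rpow (by positivity)]
    have := Real.log_le_sub_one_of_pos (show 0 < (1 + u) ^ β by positivity)
    linarith
  rwa [inv_mul_eq_div, le_div_iff₀' hβ0]

theorem abs_log_sub_log_le (ha : 0 < a) (hb : 0 < b) (hab : |a - b| ≤ h) (hβ0 : 0 < β)
    (hβ1 : β ≤ 1) :
    |Real.log a - Real.log b| ≤ β⁻¹ * h ^ β * (a ^ (-β) + b ^ (-β)) := by
  wlog hle : a ≤ b generalizing a b
  · rw [abs_sub_comm, add_comm]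
    exact this hb ha (by rwa [abs_sub_comm]) (le_of_not_ge hle)
  have hh : 0 ≤ h := (abs_nonneg _).trans hab
  have hba : b / a ≤ 1 + h / a := by
    rw [div_le_iff₀ ha, add_mul, div_mul_cancel₀ _ ha.ne']
    linarith [(abs_le.1 hab).1]
  calc |Real.log a - Real.log b| = Real.log (b / a) := by
        rw [abs_sub_comm, ← Real.log_div hb.ne' ha.ne',
          abs_of_nonneg (Real.log_nonneg ((one_le_div ha).2 hle))]
    _ ≤ Real.log (1 + h / a) := Real.log_le_log (by positivity) hba
    _ ≤ β⁻¹ * (h / a) ^ β := log_one_add_le_inv_mul_rpow (by positivity) hβ0 hβ1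
    _ = β⁻¹ * h ^ β * a ^ (-β) := by
        rw [Real.div_rpow hh ha.le, Real.rpow_neg ha.le, mul_assoc, div_eq_mul_inv]
    _ ≤ _ := by
        gcongr
        exact le_add_of_nonneg_right (by positivity)

theorem abs_inv_sub_inv_le_min (ha : 0 < a) (hb : 0 < b) (hab : |a - b| ≤ h) :
    |a⁻¹ - b⁻¹| ≤ min a⁻¹ (h * a⁻¹ ^ 2) + min b⁻¹ (h * b⁻¹ ^ 2) := by
  wlog hle : a ≤ b generalizing a b
  · rw [abs_sub_comm, add_comm]
    exact this hb ha (by rwa [abs_sub_comm]) (le_of_not_ge hle)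
  have hh : 0 ≤ h := (abs_nonneg _).trans hab
  have hba : b - a ≤ h := by linarith [(abs_le.1 hab).1]
  have hinv : b⁻¹ ≤ a⁻¹ := by gcongr
  have hpos : 0 < b⁻¹ := by positivity
  calc |a⁻¹ - b⁻¹| = a⁻¹ - b⁻¹ := abs_of_nonneg (sub_nonneg.2 hinv)
    _ ≤ min a⁻¹ (h * a⁻¹ ^ 2) := by
        refine le_min (by linarith) ?_
        calc a⁻¹ - b⁻¹ = (b - a) * (a⁻¹ * b⁻¹) := by field_simp
          _ ≤ h * a⁻¹ ^ 2 := by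
              rw [sq]
              gcongr
    _ ≤ _ := le_add_of_nonneg_right (by positivity)

end Pointwise

section Radial

variable {E : Type*} [NormedAddCommGroup E] [NormedSpace ℝ E] [FiniteDimensional ℝ E]
  [MeasurableSpace E] [BorelSpace E] {μ : Measure E} [μ.IsAddHaarMeasure]

theorem memLp_two_indicator_ball_norm_rpow [Nontrivial E] {β : ℝ}
    (hβ : 2 * β < Module.finrank ℝ E) (r : ℝ) :
    MemLp ((Metric.ball (0 : E) r).indicator fun y => ‖y‖ ^ (-β)) 2 μ := by
  have hm : Measurable fun y : E => ‖y‖ ^ (-β) := by fun_prop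
  rw [memLp_indicator_iff_restrict measurableSet_ball,
    memLp_two_iff_integrable_sq hm.aestronglyMeasurable]
  refine integrableOn_ball_of_norm_le_rpow (C := 1) Module.finrank_pos hβ
    (Eventually.of_forall fun y => le_of_eq ?_) (hm.pow_const 2).aestronglyMeasurable
  rw [Real.norm_of_nonneg (by positivity), one_mul, ← Real.rpow_mul_natCast (norm_nonneg _),
    Nat.cast_two, mul_comm, mul_neg]

theorem memLp_two_min_inv_norm (hE : Module.finrank ℝ E = 3) :
    MemLp (fun w : E => min ‖w‖⁻¹ (‖w‖⁻¹ ^ 2)) 2 μ := by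
  have : Nontrivial E := Module.nontrivial_of_finrank_pos (R := ℝ) (by simp [hE])
  have hm : Measurable fun w : E => min ‖w‖⁻¹ (‖w‖⁻¹ ^ 2) := by fun_prop
  have hnear : MemLp ((Metric.ball (0 : E) 1).indicator fun w => ‖w‖ ^ (-1 : ℝ)) 2 μ :=
    memLp_two_indicator_ball_norm_rpow (by rw [hE]; norm_num) 1
  have hfar : MemLp (fun w : E => 4 * (1 + ‖w‖) ^ (-2 : ℝ)) 2 μ := by
    refine MemLp.const_mul ?_ 4
    rw [memLp_two_iff_integrable_sq (Measurable.aestronglyMeasurable (by fun_prop))]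
    convert! integrable_one_add_norm (μ := μ) (E := E) (r := 4) (by rw [hE]; norm_num)
      using 2 with w
    rw [← Real.rpow_mul_natCast (by positivity)]
    norm_num
  refine (hnear.add hfar).mono' hm.aestronglyMeasurable (Eventually.of_forall fun w => ?_)
  rw [Real.norm_of_nonneg (by positivity), Pi.add_apply]
  by_cases hw : w ∈ Metric.ball (0 : E) 1
  · rw [indicator_of_mem hw, Real.rpow_neg_one]
    exact (min_le_left _ _).trans (le_add_of_nonneg_right (by positivity))
  · rw [indicator_of_notMem hw, zero_add]
    have hw1 : 1 ≤ ‖w‖ := by simpa using hw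
    calc min ‖w‖⁻¹ (‖w‖⁻¹ ^ 2) ≤ ‖w‖⁻¹ ^ 2 := min_le_right _ _
      _ = 4 * ((2 * ‖w‖) ^ 2)⁻¹ := by
          field_simp
          norm_num
      _ ≤ 4 * ((1 + ‖w‖) ^ 2)⁻¹ := by
          gcongr
          linarith
      _ = 4 * (1 + ‖w‖) ^ (-2 : ℝ) := by
          rw [Real.rpow_neg (by positivity), Real.rpow_two]

theorem eLpNorm_two_min_inv_norm_scaled (hE : Module.finrank ℝ E = 3) {h : ℝ} (hh : 0 < h) :
    eLpNorm (fun w : E => min ‖w‖⁻¹ (h * ‖w‖⁻¹ ^ 2)) 2 μ =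
      ENNReal.ofReal h ^ (1 / 2 : ℝ) * eLpNorm (fun w : E => min ‖w‖⁻¹ (‖w‖⁻¹ ^ 2)) 2 μ := by
  set ψ := fun w : E => min ‖w‖⁻¹ (‖w‖⁻¹ ^ 2) with hψ
  have hscale : (fun w : E => min ‖w‖⁻¹ (h * ‖w‖⁻¹ ^ 2)) = h⁻¹ • (ψ ∘ fun w => h⁻¹ • w) := by
    ext w
    have hw : ‖h⁻¹ • w‖⁻¹ = h * ‖w‖⁻¹ := by
      rw [norm_smul, Real.norm_of_nonneg (by positivity), mul_inv, inv_inv]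
    simp only [Pi.smul_apply, Function.comp_apply, hψ, hw, smul_eq_mul]
    rw [mul_min_of_nonneg _ _ (by positivity)]
    congr 1 <;> field_simp
  have hm : AEStronglyMeasurable ψ (Measure.map (fun w : E => h⁻¹ • w) μ) :=
    Measurable.aestronglyMeasurable (by fun_prop)
  have hdet : |(h⁻¹ ^ 3)⁻¹| = h ^ (3 : ℝ) := by
    rw [abs_of_nonneg (by positivity), inv_pow, inv_inv]
    norm_cast
  have hexp : h⁻¹ * (h ^ (3 : ℝ)) ^ (1 / 2 : ℝ) = h ^ (1 / 2 : ℝ) := by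
    rw [← Real.rpow_mul hh.le, ← Real.rpow_neg_one, ← Real.rpow_add hh]
    norm_num
  rw [hscale, eLpNorm_const_smul, ← eLpNorm_map_measure hm (by fun_prop),
    Measure.map_addHaar_smul _ (by positivity), eLpNorm_smul_measure_of_ne_top (by simp),
    smul_eq_mul, ← mul_assoc, hE, hdet, ENNReal.ofReal_rpow_of_pos hh, ← hexp,
    ENNReal.ofReal_mul (by positivity), Real.enorm_eq_ofReal (by positivity),
    ENNReal.ofReal_rpow_of_nonneg (by positivity) (by simp)]
  simp

end Radial

section FundSol

variable {k : ℕ}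

@[fun_prop]
theorem measurable_fundSol (k : ℕ) : Measurable (fundSol k) := by
  unfold fundSol
  split_ifs <;> fun_prop

theorem fundSol_two (r : ℝ) : fundSol 2 r = 1 / (2 * Real.pi) * Real.log r := rfl

theorem fundSol_three (r : ℝ) : fundSol 3 r = 1 / (4 * Real.pi) * r⁻¹ := rfl

theorem injOn_fundSol (k : ℕ) : InjOn (fundSol k) (Ioi 0) := by
  have := Real.pi_pos
  intro r hr r' hr' h
  unfold fundSol at h
  split_ifs at h
  · exact Real.log_injOn_pos hr hr' (mul_left_cancel₀ (by positivity) h)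
  · exact inv_injective (mul_left_cancel₀ (by positivity) h)

theorem exists_lipschitzOnWith_fundSol (k : ℕ) {c : ℝ} (hc : 0 < c) :
    ∃ L : ℝ≥0, LipschitzOnWith L (fundSol k) (Ici c) := by
  have hlog : LipschitzOnWith (2 * c⁻¹).toNNReal Real.log (Ici c) := by
    refine LipschitzOnWith.of_dist_le_mul fun r (hr : c ≤ r) r' (hr' : c ≤ r') => ?_
    have h := abs_log_sub_log_le (hc.trans_le hr) (hc.trans_le hr') le_rfl one_pos le_rfl
    rw [Real.coe_toNNReal _ (by positivity), Real.dist_eq, Real.dist_eq]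
    calc |Real.log r - Real.log r'| ≤ |r - r'| * (r⁻¹ + r'⁻¹) := by
          simpa [Real.rpow_neg_one] using h
      _ ≤ |r - r'| * (c⁻¹ + c⁻¹) := by gcongr
      _ = 2 * c⁻¹ * |r - r'| := by ring
  have hinv : LipschitzOnWith (2 * c⁻¹ ^ 2).toNNReal Inv.inv (Ici c) := by
    refine LipschitzOnWith.of_dist_le_mul fun r (hr : c ≤ r) r' (hr' : c ≤ r') => ?_
    have h := abs_inv_sub_inv_le_min (hc.trans_le hr) (hc.trans_le hr') le_rfl
    rw [Real.coe_toNNReal _ (by positivity), Real.dist_eq, Real.dist_eq]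
    calc |r⁻¹ - r'⁻¹| ≤ |r - r'| * r⁻¹ ^ 2 + |r - r'| * r'⁻¹ ^ 2 :=
          h.trans (add_le_add (min_le_right _ _) (min_le_right _ _))
      _ ≤ |r - r'| * c⁻¹ ^ 2 + |r - r'| * c⁻¹ ^ 2 := by
          have := inv_nonneg.2 (hc.le.trans hr)
          have := inv_nonneg.2 (hc.le.trans hr')
          gcongr
      _ = 2 * c⁻¹ ^ 2 * |r - r'| := by ring
  unfold fundSol
  split_ifs
  · exact ⟨_, (lipschitzWith_smul (1 / (2 * Real.pi))).comp_lipschitzOnWith hlog⟩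
  · exact ⟨_, (lipschitzWith_smul (1 / (4 * Real.pi))).comp_lipschitzOnWith hinv⟩

theorem ae_norm_sub_pos [Nonempty (Fin k)] (x : Euc k) : ∀ᵐ y, 0 < ‖x - y‖ := by
  filter_upwards [compl_mem_ae_iff.2 (measure_singleton x)] with y hy
  exact norm_pos_iff.2 (sub_ne_zero.2 fun h => hy h.symm)

theorem abs_norm_sub_sub_norm_sub_le {E : Type*} [SeminormedAddCommGroup E] (x x' y : E) :
    |‖x - y‖ - ‖x' - y‖| ≤ ‖x - x'‖ := by
  simpa using abs_norm_sub_norm_le (x - y) (x' - y)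

theorem indicator_ball_two_sub {E : Type*} [SeminormedAddCommGroup E] (F : E → ℝ) {x y : E}
    (hx : x ∈ Metric.ball 0 1) (hy : y ∈ Metric.ball 0 1) :
    (Metric.ball 0 2).indicator F (x - y) = F (x - y) := by
  rw [mem_ball_zero_iff] at hx hy
  exact indicator_of_mem (mem_ball_zero_iff.2 ((norm_sub_le x y).trans_lt (by linarith))) F

theorem memLp_norm_sub_rpow [Nonempty (Fin k)] {β : ℝ} (hβ : 2 * β < k) {x : Euc k}
    (hx : x ∈ Metric.ball 0 1) :
    MemLp (fun y => ‖x - y‖ ^ (-β)) 2 (volume.restrict (Metric.ball 0 1)) := by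
  set F := (Metric.ball (0 : Euc k) 2).indicator fun w => ‖w‖ ^ (-β)
  have hF : Measurable F := Measurable.indicator (by fun_prop) measurableSet_ball
  have hF2 : MemLp F 2 volume := memLp_two_indicator_ball_norm_rpow (by simpa using hβ) 2
  have hFx : MemLp (fun y => F (x - y)) 2 (volume.restrict (Metric.ball 0 1)) :=
    ⟨(hF.comp (by fun_prop)).aestronglyMeasurable,
      (eLpNorm_comp_sub_left_restrict_le hF x _).trans_lt hF2.2⟩
  refine hFx.ae_eq ?_
  filter_upwards [ae_restrict_mem measurableSet_ball] with y hy
  exact indicator_ball_two_sub _ hx hy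

theorem memLp_fundSol_norm_sub (hk : k = 2 ∨ k = 3) {x : Euc k} (hx : x ∈ Metric.ball 0 1) :
    MemLp (fun y => fundSol k ‖x - y‖) 2 (volume.restrict (Metric.ball 0 1)) := by
  rcases hk with rfl | rfl
  · have : IsFiniteMeasure ((volume : Measure (Euc 2)).restrict (Metric.ball 0 1)) :=
      isFiniteMeasure_restrict.2 measure_ball_lt_top.ne
    have hdom : MemLp (fun y => (1 / 2 : ℝ)⁻¹ * 2 ^ (1 / 2 : ℝ) * (‖x - y‖ ^ (-(1 / 2) : ℝ) + 1)) 2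
        (volume.restrict (Metric.ball 0 1)) :=
      ((memLp_norm_sub_rpow (by norm_num) hx).add (memLp_const 1)).const_mul _
    refine (hdom.mono' (f := fun y => Real.log ‖x - y‖)
      (Measurable.aestronglyMeasurable (by fun_prop)) ?_).const_mul (1 / (2 * Real.pi))
    filter_upwards [ae_restrict_of_ae (ae_norm_sub_pos x), ae_restrict_mem measurableSet_ball]
      with y hpos hy
    rw [mem_ball_zero_iff] at hx hy
    have hle : ‖x - y‖ ≤ 2 := by linarith [norm_sub_le x y]
    simpa using abs_log_sub_log_le (h := 2) (β := 1 / 2) hpos one_pos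
      (by rw [abs_le]; constructor <;> linarith) (by norm_num) (by norm_num)
  · simpa only [fundSol_three, Real.rpow_neg_one] using
      (memLp_norm_sub_rpow (β := 1) (by norm_num) hx).const_mul (1 / (4 * Real.pi))

theorem abs_fundSol_two_sub_le {a b h β : ℝ} (ha : 0 < a) (hb : 0 < b) (hab : |a - b| ≤ h)
    (hβ : 0 < β) (hβ1 : β ≤ 1) :
    |fundSol 2 a - fundSol 2 b| ≤
      1 / (2 * Real.pi) * β⁻¹ * h ^ β * a ^ (-β) + 1 / (2 * Real.pi) * β⁻¹ * h ^ β * b ^ (-β) :=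
  calc |fundSol 2 a - fundSol 2 b| = 1 / (2 * Real.pi) * |Real.log a - Real.log b| := by
        rw [fundSol_two, fundSol_two, ← mul_sub, abs_mul, abs_of_nonneg (by positivity)]
    _ ≤ 1 / (2 * Real.pi) * (β⁻¹ * h ^ β * (a ^ (-β) + b ^ (-β))) := by
        gcongr
        exact abs_log_sub_log_le ha hb hab hβ hβ1
    _ = _ := by ring

theorem isHolderLpOn_fundSol_two {β : ℝ≥0} (hβ : 0 < β) (hβ1 : β < 1) :
    IsHolderLpOn 2 β (fun (x y : Euc 2) => fundSol 2 ‖x - y‖) (Metric.ball 0 1)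
      (volume.restrict (Metric.ball 0 1)) := by
  set F := (Metric.ball (0 : Euc 2) 2).indicator fun w => ‖w‖ ^ (-β : ℝ)
  have hFm : Measurable F := Measurable.indicator (by fun_prop) measurableSet_ball
  have hF : eLpNorm F 2 volume ≠ ∞ :=
    (memLp_two_indicator_ball_norm_rpow (by simpa using hβ1) 2).2.ne
  lift eLpNorm F 2 volume to ℝ≥0 using hF with B hB
  set c : ℝ := 1 / (2 * Real.pi) * (β : ℝ)⁻¹
  have hc : 0 ≤ c := by positivity
  refine ⟨2 * c.toNNReal * B, fun x hx x' hx' => ?_⟩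
  have hle : eLpNorm (fun y => fundSol 2 ‖x - y‖ - fundSol 2 ‖x' - y‖) 2
      (volume.restrict (Metric.ball 0 1)) ≤
        2 * eLpNorm ((c * ‖x - x'‖ ^ (β : ℝ)) • F) 2 volume := by
    refine eLpNorm_restrict_le_two_mul_of_ae_le_comp_sub_left (hFm.const_smul _) one_le_two
      (x := x) (x' := x') ?_
    filter_upwards [ae_restrict_of_ae (ae_norm_sub_pos x), ae_restrict_of_ae (ae_norm_sub_pos x'),
      ae_restrict_mem measurableSet_ball] with y hpos hpos' hy
    simp only [Pi.smul_apply, smul_eq_mul, F, indicator_ball_two_sub _ hx hy,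
      indicator_ball_two_sub _ hx' hy]
    exact abs_fundSol_two_sub_le hpos hpos' (abs_norm_sub_sub_norm_sub_le x x' y) hβ hβ1.le
  refine hle.trans_eq ?_
  rw [eLpNorm_const_smul, ← hB, Real.enorm_eq_ofReal (by positivity), ENNReal.ofReal_mul hc,
    ← ENNReal.ofReal_rpow_of_nonneg (norm_nonneg _) β.coe_nonneg, edist_dist, dist_eq_norm]
  push_cast [ENNReal.ofReal]
  ring

theorem isHolderLpOn_fundSol_three (s : Set (Euc 3)) :
    IsHolderLpOn 2 (1 / 2) (fun (x y : Euc 3) => fundSol 3 ‖x - y‖) univ (volume.restrict s) := by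
  have hψ := (memLp_two_min_inv_norm (μ := (volume : Measure (Euc 3))) (by simp)).2.ne
  lift eLpNorm (fun w : Euc 3 => min ‖w‖⁻¹ (‖w‖⁻¹ ^ 2)) 2 volume to ℝ≥0 using hψ with B hB
  set c : ℝ := 1 / (4 * Real.pi)
  have hc : 0 ≤ c := by positivity
  refine ⟨2 * c.toNNReal * B, fun x _ x' _ => ?_⟩
  rcases eq_or_ne x x' with rfl | hne
  · simp
  have hh : 0 < ‖x - x'‖ := norm_pos_iff.2 (sub_ne_zero.2 hne)
  set ψ := fun w : Euc 3 => min ‖w‖⁻¹ (‖x - x'‖ * ‖w‖⁻¹ ^ 2)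
  have hψm : Measurable ψ := by fun_prop
  have hle : eLpNorm (fun y => fundSol 3 ‖x - y‖ - fundSol 3 ‖x' - y‖) 2
      (volume.restrict s) ≤ 2 * eLpNorm (c • ψ) 2 volume := by
    refine eLpNorm_restrict_le_two_mul_of_ae_le_comp_sub_left (hψm.const_smul _) one_le_two
      (x := x) (x' := x') ?_
    filter_upwards [ae_restrict_of_ae (ae_norm_sub_pos x), ae_restrict_of_ae (ae_norm_sub_pos x')]
      with y hpos hpos'
    simp only [Pi.smul_apply, smul_eq_mul]
    rw [fundSol_three, fundSol_three, ← mul_sub, abs_mul, abs_of_nonneg hc, ← mul_add]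
    gcongr
    exact abs_inv_sub_inv_le_min hpos hpos' (abs_norm_sub_sub_norm_sub_le x x' y)
  refine hle.trans_eq ?_
  rw [eLpNorm_const_smul, eLpNorm_two_min_inv_norm_scaled (by simp) hh, ← hB,
    Real.enorm_eq_ofReal hc, edist_dist, dist_eq_norm]
  push_cast [ENNReal.ofReal]
  ring

end FundSol

section Reflection

variable {k : ℕ} {x y : Euc k}

/-- The distance `|y| |x - y / |y|²|` from `x` to the mirror image of `y` in the unit sphere,
rescaled by `|y|`, and extended to `y = 0` by continuity; `Γ^k` of it is the regular part of the
Green function of the ball. -/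
noncomputable def reflDist (x y : Euc k) : ℝ :=
  if y = 0 then 1 else ‖y‖ * ‖x - (‖y‖ ^ 2)⁻¹ • y‖

@[fun_prop]
theorem measurable_reflDist (x : Euc k) : Measurable (reflDist x) := by
  unfold reflDist
  exact Measurable.ite (measurableSet_singleton 0) (by fun_prop) (by fun_prop)

theorem reflDist_nonneg (x y : Euc k) : 0 ≤ reflDist x y := by
  unfold reflDist
  split_ifs <;> positivity

theorem reflDist_sq (x y : Euc k) :
    reflDist x y ^ 2 = ‖x - y‖ ^ 2 + (1 - ‖x‖ ^ 2) * (1 - ‖y‖ ^ 2) := by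
  unfold reflDist
  split_ifs with hy
  · simp [hy]
  · have hy' : ‖y‖ ≠ 0 := norm_ne_zero_iff.2 hy
    rw [mul_pow, norm_sub_sq_real, norm_sub_sq_real, inner_smul_right, norm_smul, norm_inv,
      norm_pow, norm_norm]
    field_simp
    ring

theorem reflDist_zero_left (y : Euc k) : reflDist 0 y = 1 := by
  rw [← pow_eq_one_iff_of_nonneg (reflDist_nonneg 0 y) two_ne_zero, reflDist_sq]
  simp

theorem norm_sub_lt_reflDist (hx : x ∈ Metric.ball 0 1) (hy : y ∈ Metric.ball 0 1) :
    ‖x - y‖ < reflDist x y := by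
  rw [mem_ball_zero_iff] at hx hy
  refine lt_of_pow_lt_pow_left₀ 2 (reflDist_nonneg x y) ?_
  rw [reflDist_sq, lt_add_iff_pos_right]
  exact mul_pos (sub_pos.2 (pow_lt_one₀ (norm_nonneg x) hx two_ne_zero))
    (sub_pos.2 (pow_lt_one₀ (norm_nonneg y) hy two_ne_zero))

theorem one_sub_norm_le_reflDist (hx : x ∈ Metric.ball 0 1) (hy : y ∈ Metric.ball 0 1) :
    1 - ‖x‖ ≤ reflDist x y := by
  rw [mem_ball_zero_iff] at hx hy
  refine le_of_sq_le_sq ?_ (reflDist_nonneg x y)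
  have hxy : ‖x‖ * ‖y‖ ≤ ‖x‖ := mul_le_of_le_one_right (norm_nonneg x) hy.le
  have hnorm : (‖x‖ - ‖y‖) ^ 2 ≤ ‖x - y‖ ^ 2 := by
    rw [← sq_abs]
    gcongr
    exact abs_norm_sub_norm_le x y
  calc (1 - ‖x‖) ^ 2 ≤ (1 - ‖x‖ * ‖y‖) ^ 2 := by gcongr
    _ = (‖x‖ - ‖y‖) ^ 2 + (1 - ‖x‖ ^ 2) * (1 - ‖y‖ ^ 2) := by ring
    _ ≤ reflDist x y ^ 2 := by
        rw [reflDist_sq]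
        gcongr

theorem lipschitzWith_reflDist (hy : y ∈ Metric.ball 0 1) :
    LipschitzWith 1 fun x => reflDist x y := by
  refine LipschitzWith.mk_one fun x x' => ?_
  rw [mem_ball_zero_iff] at hy
  rw [Real.dist_eq, dist_eq_norm]
  unfold reflDist
  split_ifs
  · simp
  · rw [← mul_sub, abs_mul, abs_norm]
    exact (mul_le_of_le_one_left (abs_nonneg _) hy.le).trans (abs_norm_sub_sub_norm_sub_le _ _ _)

theorem exists_lipschitzOnWith_fundSol_reflDist (k : ℕ) {c : ℝ} (hc : 0 < c) :
    ∃ L : ℝ≥0, ∀ y : Euc k, y ∈ Metric.ball 0 1 →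
      LipschitzOnWith L (fun x => fundSol k (reflDist x y))
        (Metric.ball 0 1 ∩ {x | c ≤ 1 - ‖x‖}) := by
  obtain ⟨L, hL⟩ := exists_lipschitzOnWith_fundSol k hc
  exact ⟨L * 1, fun y hy => hL.comp (lipschitzWith_reflDist hy).lipschitzOnWith
    fun x hx => hx.2.trans (one_sub_norm_le_reflDist hx.1 hy)⟩

end Reflection

section Domain

variable {k : ℕ} {b : ℝ}

theorem domain_eq_ball (hk : k = 2 ∨ k = 3) (b : ℝ) : domain k b = Metric.ball 0 1 := by
  rcases hk with rfl | rfl <;> simp [domain]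

theorem mem_domain_one {x : Euc 1} : x ∈ domain 1 b ↔ x 0 ∈ Ioo 0 b := by
  simp [domain]

theorem isOpen_domain (k : ℕ) (b : ℝ) : IsOpen (domain k b) := by
  unfold domain
  split_ifs
  · simp only [ofPred_forall]
    exact isOpen_iInter_of_finite fun i => isOpen_Ioo.preimage (by fun_prop)
  · exact Metric.isOpen_ball

theorem isBounded_domain (k : ℕ) (b : ℝ) : Bornology.IsBounded (domain k b) := by
  by_cases hk : k = 1
  · subst hk
    refine (Metric.isBounded_closedBall (x := 0) (r := b)).subset fun x hx => ?_
    obtain ⟨h0, hb⟩ := mem_domain_one.1 hx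
    rw [mem_closedBall_zero_iff, EuclideanSpace.norm_eq, Fin.sum_univ_one,
      Real.norm_of_nonneg h0.le, Real.sqrt_sq h0.le]
    exact hb.le
  · simp only [domain, if_neg hk]
    exact Metric.isBounded_ball

instance isFiniteMeasure_restrict_domain (k : ℕ) (b : ℝ) :
    IsFiniteMeasure ((volume : Measure (Euc k)).restrict (domain k b)) :=
  isFiniteMeasure_restrict.2 (isBounded_domain k b).measure_lt_top.ne

theorem xi_pos (hk : k = 1 ∨ k = 2 ∨ k = 3) {γ : ℝ} (hγ1 : γ < 1) : 0 < xi k γ := by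
  rcases hk with rfl | rfl | rfl <;> simp [xi, hγ1]

theorem xi_le_one (hk : k = 1 ∨ k = 2 ∨ k = 3) {γ : ℝ} (hγ0 : 0 < γ) : xi k γ ≤ 1 := by
  rcases hk with rfl | rfl | rfl <;> simp [xi, hγ0.le]
  norm_num

end Domain

section Green

variable {k : ℕ} {b γ : ℝ}

theorem green_one (b : ℝ) (x y : Euc 1) : green 1 b x y = min (x 0) (y 0) - x 0 * y 0 / b := rfl

theorem green_eq (hk : k = 2 ∨ k = 3) (b : ℝ) :
    green k b = (fun x y => fundSol k ‖x - y‖) - fun x y => fundSol k (reflDist x y) := by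
  ext x y
  rcases hk with rfl | rfl <;> by_cases hy : y = 0 <;> simp [green, reflDist, hy]

theorem measurable_green_one (b : ℝ) (x : Euc 1) : Measurable (green 1 b x) := by
  simp only [funext (green_one b x)]
  fun_prop

theorem lipschitzWith_green_one {y : Euc 1} (hy : y ∈ domain 1 b) :
    LipschitzWith 2 fun x => green 1 b x y := by
  obtain ⟨hy0, hyb⟩ := mem_domain_one.1 hy
  refine LipschitzWith.of_dist_le_mul fun x x' => ?_
  have hnorm : |x 0 - x' 0| ≤ dist x x' := by
    simpa [dist_eq_norm] using PiLp.norm_apply_le (x - x') 0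
  have hmin : |min (x 0) (y 0) - min (x' 0) (y 0)| ≤ |x 0 - x' 0| := by
    simpa using abs_min_sub_min_le_max (x 0) (y 0) (x' 0) (y 0)
  have hlin : |(x 0 - x' 0) * (y 0 / b)| ≤ |x 0 - x' 0| := by
    rw [abs_mul, abs_of_pos (div_pos hy0 (hy0.trans hyb))]
    exact mul_le_of_le_one_right (abs_nonneg _) ((div_le_one (hy0.trans hyb)).2 hyb.le)
  calc dist (green 1 b x y) (green 1 b x' y)
      = |(min (x 0) (y 0) - min (x' 0) (y 0)) - (x 0 - x' 0) * (y 0 / b)| := by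
        rw [Real.dist_eq, green_one, green_one]
        congr 1
        ring
    _ ≤ |min (x 0) (y 0) - min (x' 0) (y 0)| + |(x 0 - x' 0) * (y 0 / b)| := abs_sub _ _
    _ ≤ 2 * dist x x' := by linarith

theorem green_ne_zero (hk : k = 1 ∨ k = 2 ∨ k = 3) {x y : Euc k} (hx : x ∈ domain k b)
    (hy : y ∈ domain k b) (hxy : 0 < ‖x - y‖) : green k b x y ≠ 0 := by
  rcases hk with rfl | hk
  · obtain ⟨hx0, hxb⟩ := mem_domain_one.1 hx
    obtain ⟨hy0, hyb⟩ := mem_domain_one.1 hy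
    have hb : 0 < b := hx0.trans hxb
    rw [green_one]
    refine (sub_pos.2 (lt_min ?_ ?_)).ne' <;> rw [div_lt_iff₀ hb] <;> nlinarith
  · rw [domain_eq_ball hk] at hx hy
    rw [green_eq hk, Pi.sub_apply, Pi.sub_apply, sub_ne_zero]
    have hlt := norm_sub_lt_reflDist hx hy
    exact (injOn_fundSol k).ne hxy (hxy.trans hlt) hlt.ne

theorem memLp_fundSol_reflDist {x : Euc k} (hx : x ∈ Metric.ball 0 1) :
    MemLp (fun y => fundSol k (reflDist x y)) 2 (volume.restrict (Metric.ball 0 1)) := by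
  have : IsFiniteMeasure ((volume : Measure (Euc k)).restrict (Metric.ball 0 1)) :=
    isFiniteMeasure_restrict.2 measure_ball_lt_top.ne
  have hx1 : ‖x‖ < 1 := mem_ball_zero_iff.1 hx
  obtain ⟨L, hL⟩ := exists_lipschitzOnWith_fundSol_reflDist k (sub_pos.2 hx1)
  refine MemLp.of_bound (Measurable.aestronglyMeasurable (by fun_prop)) (L * ‖x‖ + |fundSol k 1|) ?_
  filter_upwards [ae_restrict_mem measurableSet_ball] with y hy
  have hdist := (hL y hy).dist_le_mul x ⟨hx, le_refl (1 - ‖x‖)⟩ 0 (by simp)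
  rw [reflDist_zero_left, Real.dist_eq, dist_zero_right] at hdist
  have := abs_sub_abs_le_abs_sub (fundSol k (reflDist x y)) (fundSol k 1)
  rw [Real.norm_eq_abs]
  linarith

theorem memLp_green (hk : k = 1 ∨ k = 2 ∨ k = 3) {x : Euc k} (hx : x ∈ domain k b) :
    MemLp (green k b x) 2 (volume.restrict (domain k b)) := by
  rcases hk with rfl | hk
  · refine MemLp.of_bound (measurable_green_one b x).aestronglyMeasurable (2 * ‖x‖) ?_
    filter_upwards [ae_restrict_mem (isOpen_domain 1 b).measurableSet] with y hy
    simpa [green_one, (mem_domain_one.1 hy).1.le] using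
      (lipschitzWith_green_one hy).dist_le_mul x 0
  · rw [domain_eq_ball hk] at hx ⊢
    rw [green_eq hk]
    exact (memLp_fundSol_norm_sub hk hx).sub (memLp_fundSol_reflDist hx)

theorem isHolderLpOn_green_one (b : ℝ) :
    IsHolderLpOn 2 1 (green 1 b) univ (volume.restrict (domain 1 b)) := by
  refine IsHolderLpOn.of_ae_lipschitzOnWith (L := 2) ?_
  filter_upwards [ae_restrict_mem (isOpen_domain 1 b).measurableSet] with y hy
  exact (lipschitzWith_green_one hy).lipschitzOnWith

theorem isHolderLpOn_fundSol (hk : k = 2 ∨ k = 3) (hγ0 : 0 < γ) (hγ1 : γ < 1) :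
    IsHolderLpOn 2 (xi k γ).toNNReal (fun x y : Euc k => fundSol k ‖x - y‖) (Metric.ball 0 1)
      (volume.restrict (Metric.ball 0 1)) := by
  rcases hk with rfl | rfl
  · have hxi : xi 2 γ = 1 - γ := by simp [xi]
    rw [hxi]
    exact isHolderLpOn_fundSol_two (by simpa using hγ1) (by simpa using hγ0)
  · have hxi : (xi 3 γ).toNNReal = 1 / 2 := by
      rw [show xi 3 γ = ((1 / 2 : ℝ≥0) : ℝ) by simp [xi], Real.toNNReal_coe]
    rw [hxi]
    exact (isHolderLpOn_fundSol_three _).mono (subset_univ _)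

theorem isHolderLpOn_fundSol_reflDist {K : Set (Euc k)} (hK : IsCompact K)
    (hKD : K ⊆ Metric.ball 0 1) :
    IsHolderLpOn 2 1 (fun x y : Euc k => fundSol k (reflDist x y)) K
      (volume.restrict (Metric.ball 0 1)) := by
  have : IsFiniteMeasure ((volume : Measure (Euc k)).restrict (Metric.ball 0 1)) :=
    isFiniteMeasure_restrict.2 measure_ball_lt_top.ne
  obtain ⟨c, hc, hcK⟩ : ∃ c : ℝ, 0 < c ∧ ∀ x ∈ K, c ≤ 1 - ‖x‖ :=
    hK.exists_forall_le' (by fun_prop) fun x hx => sub_pos.2 (mem_ball_zero_iff.1 (hKD hx))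
  obtain ⟨L, hL⟩ := exists_lipschitzOnWith_fundSol_reflDist k hc
  refine IsHolderLpOn.of_ae_lipschitzOnWith (L := L) ?_
  filter_upwards [ae_restrict_mem measurableSet_ball] with y hy
  exact (hL y hy).mono fun x hx => ⟨hKD hx, hcK x hx⟩

theorem isHolderLpOn_green (hk : k = 1 ∨ k = 2 ∨ k = 3) (hγ0 : 0 < γ) (hγ1 : γ < 1)
    {K : Set (Euc k)} (hK : IsCompact K) (hKD : K ⊆ domain k b) :
    IsHolderLpOn 2 (xi k γ).toNNReal (green k b) K (volume.restrict (domain k b)) := by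
  have hdiam : Metric.ediam K ≠ ∞ := hK.isBounded.ediam_ne_top
  have hξ : (xi k γ).toNNReal ≤ 1 := Real.toNNReal_le_one.2 (xi_le_one hk hγ0)
  rcases hk with rfl | hk
  · exact ((isHolderLpOn_green_one b).mono (subset_univ K)).of_le hdiam hξ
  · rw [domain_eq_ball hk] at hKD ⊢
    rw [green_eq hk]
    exact ((isHolderLpOn_fundSol hk hγ0 hγ1).mono hKD).sub one_le_two
      ((isHolderLpOn_fundSol_reflDist hK hKD).of_le hdiam hξ)
      (fun x _ => Measurable.aestronglyMeasurable (by fun_prop))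
      fun x _ => Measurable.aestronglyMeasurable (by fun_prop)

open Classical in
/-- The class of `y ↦ green k b x y` in `L²(D)`, which makes sense for `x ∈ D`; it is set to `0`
when the function is not square integrable. -/
noncomputable def greenLp (k : ℕ) (b : ℝ) (x : Euc k) :
    Lp ℝ 2 ((volume : Measure (Euc k)).restrict (domain k b)) :=
  if h : MemLp (green k b x) 2 (volume.restrict (domain k b)) then h.toLp (green k b x) else 0

theorem coeFn_greenLp (hk : k = 1 ∨ k = 2 ∨ k = 3) {x : Euc k} (hx : x ∈ domain k b) :
    greenLp k b x =ᵐ[volume.restrict (domain k b)] green k b x := by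
  have h := memLp_green hk hx
  rw [greenLp, dif_pos h]
  exact h.coeFn_toLp

theorem wienerIntegral_green (hk : k = 1 ∨ k = 2 ∨ k = 3) {x : Euc k} (hx : x ∈ domain k b)
    {Ω : Type*} (W : Lp ℝ 2 ((volume : Measure (Euc k)).restrict (domain k b)) → Ω → ℝ) :
    wienerIntegral W (green k b x) = W (greenLp k b x) := by
  have h := memLp_green hk hx
  rw [wienerIntegral, greenLp, dif_pos h, dif_pos h]

theorem exists_holderOnWith_greenLp (hk : k = 1 ∨ k = 2 ∨ k = 3) (hγ0 : 0 < γ) (hγ1 : γ < 1)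
    {K : Set (Euc k)} (hK : IsCompact K) (hKD : K ⊆ domain k b) :
    ∃ L : ℝ≥0, HolderOnWith L (xi k γ).toNNReal (greenLp k b) K :=
  (isHolderLpOn_green hk hγ0 hγ1 hK hKD).exists_holderOnWith_toLp
    fun _ hx => coeFn_greenLp hk (hKD hx)

theorem greenLp_ne_zero (hk : k = 1 ∨ k = 2 ∨ k = 3) {x : Euc k} (hx : x ∈ domain k b) :
    greenLp k b x ≠ 0 := by
  have : Nonempty (Fin k) := by
    rcases hk with rfl | rfl | rfl <;> infer_instance
  intro hzero
  have hfalse : ∀ᵐ _ ∂volume.restrict (domain k b), False := by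
    filter_upwards [Lp.eq_zero_iff_ae_eq_zero.1 hzero, coeFn_greenLp hk hx,
      ae_restrict_of_ae (ae_norm_sub_pos x),
      ae_restrict_mem (isOpen_domain k b).measurableSet] with y hy hgreen hxy hyD
    exact green_ne_zero hk hx hyD hxy (hgreen.symm.trans hy)
  rw [eventually_false_iff_eq_bot, ae_eq_bot, Measure.restrict_eq_zero] at hfalse
  exact ((isOpen_domain k b).measure_pos volume ⟨x, hx⟩).ne' hfalse

end Green

section InnerCompact

theorem thickening_subset_of_le_infDist_frontier {E : Type*} [NormedAddCommGroup E]
    [NormedSpace ℝ E] [FiniteDimensional ℝ E] {I D : Set E} {r : ℝ} (hID : I ⊆ D)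
    (h : ∀ x ∈ I, r ≤ Metric.infDist x (frontier D)) : Metric.thickening r I ⊆ D := by
  intro y hy
  obtain ⟨x, hxI, hyx⟩ := Metric.mem_thickening_iff.1 hy
  by_contra hyD
  obtain ⟨w, hw, hwx⟩ :=
    exists_mem_frontier_infDist_compl_eq_dist (hID hxI) fun h => hyD (h ▸ mem_univ y)
  refine hyx.not_ge ?_
  calc r ≤ Metric.infDist x (frontier D) := h x hxI
    _ ≤ dist x w := Metric.infDist_le_dist_of_mem hw
    _ = Metric.infDist x Dᶜ := hwx.symm
    _ ≤ dist x y := Metric.infDist_le_dist_of_mem hyD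
    _ = dist y x := dist_comm x y

theorem exists_isCompact_thickening_half_subset {X : Type*} [PseudoMetricSpace X] [ProperSpace X]
    {D : Set X} (hD : Bornology.IsBounded D) {r : ℝ} (hr : 0 < r) :
    ∃ K ⊆ D, IsCompact K ∧
      ∀ I, Metric.thickening r I ⊆ D → Metric.thickening (r / 2) I ⊆ K := by
  have hKD : (Metric.thickening (r / 2) Dᶜ)ᶜ ⊆ D :=
    compl_subset_comm.1 (Metric.self_subset_thickening (half_pos hr) Dᶜ)
  refine ⟨(Metric.thickening (r / 2) Dᶜ)ᶜ, hKD, Metric.isCompact_of_isClosed_isBounded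
    Metric.isOpen_thickening.isClosed_compl (hD.subset hKD), fun I hI y hyI hyD => ?_⟩
  obtain ⟨x, hxI, hyx⟩ := Metric.mem_thickening_iff.1 hyI
  obtain ⟨z, hzD, hyz⟩ := Metric.mem_thickening_iff.1 hyD
  refine hzD (hI (Metric.mem_thickening_iff.2 ⟨x, hxI, ?_⟩))
  linarith [dist_triangle_left z x y]

end InnerCompact

section WhiteNoise

variable {S Ω : Type*} [MeasurableSpace S] [MeasurableSpace Ω] {d : ℕ} {P : Measure Ω}

theorem IsWhiteNoise.isIsonormal {μ : Measure S} {W : Fin d → Lp ℝ 2 μ → Ω → ℝ}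
    (hW : IsWhiteNoise μ W P) (i : Fin d) : IsIsonormal (W i) P where
  isGaussianProcess := hW.isGaussianProcess.comp_right fun h => (i, h)
  mean_zero := hW.mean_zero i
  covariance g h := by simpa using hW.covariance i i g h

theorem IsWhiteNoise.iIndepFun {μ : Measure S} {W : Fin d → Lp ℝ 2 μ → Ω → ℝ}
    (hW : IsWhiteNoise μ W P) : ProbabilityTheory.iIndepFun (fun i ω h => W i h ω) P := by
  have := hW.isGaussianProcess.isProbabilityMeasure
  refine IsGaussianProcess.iIndepFun_of_covariance_eq_zero (S := fun _ => Lp ℝ 2 μ) (X := W)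
    (hW.isGaussianProcess.comp_right fun p : (_ : Fin d) × Lp ℝ 2 μ => (p.1, p.2))
    (fun i h => (hW.isIsonormal i).aemeasurable h) fun i j hij g h => ?_
  rw [covariance_eq_sub ((hW.isIsonormal i).memLp_two g) ((hW.isIsonormal j).memLp_two h),
    hW.mean_zero, hW.mean_zero]
  simpa [hij] using hW.covariance i j g h

theorem IsGaussianSolution.isIsonormalField {k : ℕ} (hk : k = 1 ∨ k = 2 ∨ k = 3) {b : ℝ}
    {W : Fin d → Lp ℝ 2 ((volume : Measure (Euc k)).restrict (domain k b)) → Ω → ℝ}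
    {v : Euc k → Ω → Euc d} (hv : IsGaussianSolution b W v P)
    (hW : IsWhiteNoise (volume.restrict (domain k b)) W P) {K : Set (Euc k)}
    (hKD : K ⊆ domain k b) : IsIsonormalField W (greenLp k b) K v P where
  isIsonormal := hW.isIsonormal
  iIndepFun := hW.iIndepFun
  ae_eq x hx i := by
    rw [← wienerIntegral_green hk (hKD hx) (W i)]
    exact hv.ae_eq x (hKD hx) i
  ae_continuousOn := hv.ae_continuousOn.mono fun _ hω => hω.mono hKD

end WhiteNoise

end PoissonHitting

theorem mainTheorem2_general (k d : ℕ) (hk : k = 1 ∨ k = 2 ∨ k = 3) (b : ℝ)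
    (γ : ℝ) (hγ0 : 0 < γ) (hγ1 : γ < 1) (d₀ : ℝ) (hd₀ : 0 < d₀) :
    ∃ C : ℝ, 0 < C ∧
      ∀ (Ω : Type*) [MeasurableSpace Ω] (P : Measure Ω)
        (W : Fin d → Lp ℝ 2 ((volume : Measure (Euc k)).restrict (domain k b)) → Ω → ℝ)
        (v : Euc k → Ω → Euc d),
        IsWhiteNoise ((volume : Measure (Euc k)).restrict (domain k b)) W P →
        IsGaussianSolution b W v P →
        ∀ I : Set (Euc k), I ⊆ domain k b →
          (∀ x ∈ I, d₀ ≤ Metric.infDist x (frontier (domain k b))) →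
          ∀ A : Set (Euc d),
            P {ω | (((fun x => v x ω) '' I) ∩ A).Nonempty} ≤
              ENNReal.ofReal C * μH[(d : ℝ) - (k : ℝ) / xi k γ] A := by
  obtain ⟨K, hKD, hK, hIK⟩ := exists_isCompact_thickening_half_subset (isBounded_domain k b) hd₀
  obtain ⟨L, hL⟩ := exists_holderOnWith_greenLp hk hγ0 hγ1 hK hKD
  have hξ : 0 < xi k γ := xi_pos hk hγ1
  obtain ⟨C, hC, hitting⟩ := exists_measure_image_inter_nonempty_le d hK (Real.toNNReal_pos.2 hξ)
    hL (fun x hx => greenLp_ne_zero hk (hKD hx)) (half_pos hd₀)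
  refine ⟨C, hC, fun Ω _ P W v hW hv I hID hI A => ?_⟩
  have hIr : Metric.thickening (d₀ / 2) I ⊆ K :=
    hIK I (thickening_subset_of_le_infDist_frontier hID hI)
  simpa only [ENNReal.ofReal_coe_nnreal, Real.coe_toNNReal _ hξ.le] using
    hitting (hv.isIsonormalField hk hW hKD) I hIr A

theorem mainTheorem2 (k d : ℕ) (hk : k = 1 ∨ k = 2 ∨ k = 3) (b : ℝ) (hb : 0 < b)
    (γ : ℝ) (hγ0 : 0 < γ) (hγ1 : γ < 1) (d₀ : ℝ) (hd₀ : 0 < d₀) :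
    ∃ C : ℝ, 0 < C ∧
      ∀ (Ω : Type*) [MeasurableSpace Ω] (P : Measure Ω) [IsProbabilityMeasure P]
        (W : Fin d → Lp ℝ 2 ((volume : Measure (Euc k)).restrict (domain k b)) → Ω → ℝ)
        (v : Euc k → Ω → Euc d),
        IsWhiteNoise ((volume : Measure (Euc k)).restrict (domain k b)) W P →
        IsGaussianSolution b W v P →
        ∀ I : Set (Euc k), IsCompact I → I ⊆ domain k b →
          (∀ x ∈ I, d₀ ≤ Metric.infDist x (frontier (domain k b))) →
          ∀ A : Set (Euc d), MeasurableSet A →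
            P {ω | (((fun x => v x ω) '' I) ∩ A).Nonempty} ≤
              ENNReal.ofReal C * μH[(d : ℝ) - (k : ℝ) / xi k γ] A := by
  obtain ⟨C, hC, h⟩ := mainTheorem2_general k d hk b γ hγ0 hγ1 d₀ hd₀
  exact ⟨C, hC, fun Ω _ P _ W v hW hv I _ hID hI A _ => h Ω P W v hW hv I hID hI A⟩
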